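/- Let $k$ be an algebraically closed field of characteristic $p>0$, let $e\ge 1$, $q=p^e$, and $d=q+1\ge 5$. A \emph{smooth extremal surface} of degree $d$ over $k$ is a smooth surface $X=\mathbb V(F)\subset\mathbb P^3_k$ defined by a form $F=\sum_{i=1}^4 x_i^{q}L_i$, where $L_1,\dots,L_4$ are linear forms in the homogeneous coordinates $x_1,\dots,x_4$. A \emph{double $2d$} is an unordered pair $\{\mathcal A,\mathcal B\}$ of sets, each consisting of $2d$ lines in $\mathbb P^3_k$, such that any two distinct lines of $\mathcal A$ (resp. of $\mathcal B$) are skew, and each line of $\mathcal A$ (resp. $\mathcal B$) intersects exactly $d+2$ lines of $\mathcal B$ (resp. $\mathcal A$). It is contained in $X$ if all of its lines lie on $X$. Then every smooth extremal surface of degree $d=q+1\geq 5$ contains at least $$\frac{1}{16}(q^3+1)(q^2+1)(q-1)^2q^7$$ distinct double $2d$'s. With $q=d-1$, this lower bound is asymptotically equivalent to $\frac1{16}d^{14}$ as $d\to\infty$. -/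

import Mathlib

open Filter Asymptotics

/-- A Frobenius form of degree `q + 1` in the four variables of projective three-space:
a polynomial `∑ xᵢ ^ q * Lᵢ` where the `Lᵢ` are linear forms. -/
def IsFrobeniusForm {k : Type*} [Field k] (q : ℕ) (F : MvPolynomial (Fin 4) k) : Prop :=
  ∃ L : Fin 4 → MvPolynomial (Fin 4) k,
    (∀ i, (L i).IsHomogeneous 1) ∧ F = ∑ i, MvPolynomial.X i ^ q * L i

/-- The surface `𝕍(F)` in projective three-space is smooth (Jacobian criterion, to be used over
an algebraically closed field): at each point of the surface, i.e. at each nonzero vector of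
homogeneous coordinates where `F` vanishes, some partial derivative of `F` does not vanish. -/
def IsSmoothSurface {k : Type*} [Field k] (F : MvPolynomial (Fin 4) k) : Prop :=
  ∀ v : Fin 4 → k, v ≠ 0 → MvPolynomial.eval v F = 0 →
    ∃ i, MvPolynomial.eval v (MvPolynomial.pderiv i F) ≠ 0

/-- The surface `𝕍(F)` is a smooth extremal surface of degree `q + 1`. -/
def IsSmoothExtremalSurface {k : Type*} [Field k] (q : ℕ) (F : MvPolynomial (Fin 4) k) : Prop :=
  IsFrobeniusForm q F ∧ IsSmoothSurface F

/-- The lines of projective three-space over `k`: the two-dimensional subspaces of `k⁴`. -/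
def ProjLine (k : Type*) [Field k] : Type _ :=
  {W : Submodule k (Fin 4 → k) // Module.finrank k W = 2}

/-- Two lines of projective three-space are skew if they have no common point, that is, if the
corresponding two-dimensional subspaces meet only in the zero vector. -/
def ProjLine.Skew {k : Type*} [Field k] (l m : ProjLine k) : Prop :=
  l.1 ⊓ m.1 = ⊥

/-- The line `l` lies on the surface `𝕍(F)`. -/
def ProjLine.LiesOn {k : Type*} [Field k] (l : ProjLine k) (F : MvPolynomial (Fin 4) k) : Prop :=
  ∀ v ∈ l.1, MvPolynomial.eval v F = 0

/-- Two sets `A`, `B` of lines in projective three-space form a double `2d`: each consists of `2d`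
lines, the lines within each set are pairwise skew, and each line of one set intersects exactly
`d + 2` lines of the other set. -/
structure FormDouble {k : Type*} [Field k] (d : ℕ) (A B : Set (ProjLine k)) : Prop where
  card_left : A.encard = 2 * d
  card_right : B.encard = 2 * d
  skew_left : ∀ l ∈ A, ∀ m ∈ A, l ≠ m → l.Skew m
  skew_right : ∀ l ∈ B, ∀ m ∈ B, l ≠ m → l.Skew m
  meets_left : ∀ l ∈ A, {m ∈ B | ¬ l.Skew m}.encard = d + 2
  meets_right : ∀ m ∈ B, {l ∈ A | ¬ m.Skew l}.encard = d + 2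

/-- The collection of all double `2d`'s contained in the surface `𝕍(F)`. A double `2d` is the
unordered pair `{A, B}`, so exchanging `A` and `B` does not give a new one. -/
def doublesOn {k : Type*} [Field k] (d : ℕ) (F : MvPolynomial (Fin 4) k) :
    Set (Sym2 (Set (ProjLine k))) :=
  {D | ∃ A B : Set (ProjLine k), D = s(A, B) ∧ FormDouble d A B ∧
    (∀ l ∈ A, l.LiesOn F) ∧ (∀ l ∈ B, l.LiesOn F)}

/-! Write `F(v) = β(v, v)` with `β(x, y) = ∑ xᵢ ^ q Aᵢⱼ yⱼ`, Frobenius-semilinear in `x`. Since `q =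
0` in `k`, the partial derivatives of `F` at `v` are the values `β(v, eⱼ)`, so smoothness makes `β`
nondegenerate. By a Lang-type argument such a `β` is Hermitian over the field with `q ^ 2` elements
on a suitable spanning set of vectors. It therefore has orthonormal frames, at least as many as the
standard Hermitian form, and in each of them the surface is the Fermat surface.

Given an orthonormal frame and `r ^ (q + 1) = 1`, the quadric `r x₀ x₁ = x₂ x₃` carries `q + 1`
lines of the surface in each of its two rulings. For `r ≠ r'`, take one ruling of the first quadric
together with the opposite ruling of the second; the remaining two rulings form the other half. A
line meets all `q + 1` lines of the opposite ruling of its quadric and exactly two of the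
corresponding ruling of the other quadric, hence `d + 2` lines of the other half.

It remains to bound how many triples (frame, `r`, `r'`) give the same double. Because `q + 1 > 4`,
incidences recover the four rulings up to 4 possibilities (`decomposition_eq_or`). Intersections of
rulings recover four edges of the coordinate tetrahedron up to 4 labellings (`span_pairs_eq_or`),
and the edges recover the frame up to scalars in `μ_{q+1}`. So fibres have at most `16 (q + 1) ^ 4`
elements, and dividing the number of triples by this is exactly the stated bound. -/

/-! ### Fixed vectors of Frobenius-semilinear maps -/

open Polynomial in
/-- Polynomials obtained by iterating `c ↦ c ^ Q + aᵢ X ^ Q`. -/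
noncomputable def frobeniusIterates {k : Type*} [Field k] (Q : ℕ) (a : ℕ → k) : ℕ → k[X]
  | 0 => C (a 0) * X ^ Q
  | i + 1 => frobeniusIterates Q a i ^ Q + C (a (i + 1)) * X ^ Q

open Polynomial in
theorem X_pow_dvd_frobeniusIterates {k : Type*} [Field k] {Q : ℕ} (hQ : 2 ≤ Q) (a : ℕ → k)
    (i : ℕ) : X ^ Q ∣ frobeniusIterates Q a i := by
  induction i with
  | zero => exact Dvd.intro_left _ rfl
  | succ i ih =>
    exact dvd_add (ih.trans (dvd_pow_self _ (by omega))) (Dvd.intro_left _ rfl)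

-- No cancellation can occur: a nonzero iterate is divisible by `X ^ Q`, so its `Q`-th power has
-- degree at least `Q ^ 2 > Q`, too large to cancel the new term.
open Polynomial in
theorem frobeniusIterates_ne_zero {k : Type*} [Field k] {Q : ℕ} (hQ : 2 ≤ Q) (a : ℕ → k)
    {i j : ℕ} (hj : j ≤ i) (ha : a j ≠ 0) : frobeniusIterates Q a i ≠ 0 := by
  induction i with
  | zero =>
    obtain rfl : j = 0 := by omega
    simp [frobeniusIterates, ha]
  | succ i ih =>
    intro h0
    rw [frobeniusIterates] at h0
    rcases Nat.lt_or_ge i j with hij | hij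
    · obtain rfl : j = i + 1 := by omega
      by_cases hi : frobeniusIterates Q a i = 0
      · rw [hi, zero_pow (by omega)] at h0
        simp [ha] at h0
      · have h1 : frobeniusIterates Q a i ^ Q = C (-a (i + 1)) * X ^ Q := by
          rw [C_neg]; linear_combination h0
        have h2 := congrArg natDegree h1
        rw [natDegree_pow, natDegree_C_mul_X_pow _ _ (neg_ne_zero.2 ha)] at h2
        have h3 := natDegree_le_of_dvd (X_pow_dvd_frobeniusIterates hQ a i) hi
        rw [natDegree_X_pow] at h3
        nlinarith
    · have hi := ih hij
      have h1 : frobeniusIterates Q a i ^ Q = C (-a (i + 1)) * X ^ Q := by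
        rw [C_neg]; linear_combination h0
      have h2 := congrArg natDegree h1
      have h4 := natDegree_C_mul_X_pow_le (-a (i + 1)) Q
      rw [natDegree_pow] at h2
      have h3 := natDegree_le_of_dvd (X_pow_dvd_frobeniusIterates hQ a i) hi
      rw [natDegree_X_pow] at h3
      nlinarith

-- Dividing the fixed-point equation by `x` leaves `x ^ (Q - 1) S(x) = 1`, a nonconstant polynomial
-- equation that excludes `x = 0`.
open Polynomial in
theorem exists_ne_zero_eval_frobeniusIterates {k : Type*} [Field k] [IsAlgClosed k] {Q : ℕ}
    (hQ : 2 ≤ Q) (a : ℕ → k) {i j : ℕ} (hj : j ≤ i) (ha : a j ≠ 0) :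
    ∃ x ≠ 0, (frobeniusIterates Q a i).eval x = x := by
  obtain ⟨S, hS⟩ := X_pow_dvd_frobeniusIterates hQ a i
  have hS0 : S ≠ 0 := by
    rintro rfl
    exact frobeniusIterates_ne_zero hQ a hj ha (by simpa using hS)
  obtain ⟨x, hx⟩ := IsAlgClosed.exists_root (X ^ (Q - 1) * S - 1) (by
    intro h
    have h1 := natDegree_eq_zero_iff_degree_le_zero.2 h.le
    rw [← C_1, natDegree_sub_C, natDegree_mul (by simp) hS0, natDegree_X_pow] at h1
    omega)
  have hx1 : x ^ (Q - 1) * S.eval x = 1 := by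
    have : x ^ (Q - 1) * S.eval x - 1 = 0 := by simpa [IsRoot] using hx
    linear_combination this
  refine ⟨x, ?_, ?_⟩
  · rintro rfl
    rw [zero_pow (by omega)] at hx1
    simp at hx1
  · obtain ⟨R, rfl⟩ : ∃ R, Q = R + 1 := ⟨Q - 1, by omega⟩
    rw [hS]
    simp only [eval_mul, eval_pow, eval_X]
    rw [Nat.add_sub_cancel] at hx1
    linear_combination x * hx1

/-- Take the first relation `φ^(N+1) v = ∑ aᵢ φ^i v` among the iterates of some `v ≠ 0` and look for
a fixed vector `∑ cᵢ φ^i v`. With `x = c_N`, comparing coefficients gives `c₀ = x ^ Q a₀` and `cᵢ₊₁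
= cᵢ ^ Q + x ^ Q aᵢ₊₁`, so everything reduces to one equation in `x`. -/
theorem exists_ne_zero_fixed_of_semilinear {k V : Type*} [Field k] [IsAlgClosed k]
    [AddCommGroup V] [Module k V] [FiniteDimensional k V] [Nontrivial V] {Q : ℕ} (hQ : 2 ≤ Q)
    (φ : V →+ V) (hsmul : ∀ (c : k) x, φ (c • x) = c ^ Q • φ x)
    (hinj : Function.Injective φ) : ∃ v ≠ 0, φ v = v := by
  obtain ⟨v, hv⟩ := exists_ne (0 : V)
  let s : ℕ → Submodule k V := fun n => Submodule.span k (Set.range fun i : Fin n => φ^[i] v)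
  have hmem : ∀ {i n : ℕ}, i < n → φ^[i] v ∈ s n := fun {i n} h =>
    Submodule.subset_span ⟨⟨i, h⟩, rfl⟩
  have hmono : Monotone s := by
    intro m n hmn
    refine Submodule.span_le.2 ?_
    rintro _ ⟨i, rfl⟩
    exact hmem (i.2.trans_le hmn)
  have hex : ∃ n, φ^[n] v ∈ s n := by
    obtain ⟨n, hn⟩ := monotone_stabilizes_iff_noetherian.2 (inferInstance : IsNoetherian k V)
      ⟨s, hmono⟩
    refine ⟨n, ?_⟩
    have h1 : s n = s (n + 1) := hn (n + 1) (by omega)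
    rw [h1]
    exact hmem (by omega)
  classical
  obtain ⟨N, hN⟩ : ∃ N, Nat.find hex = N + 1 := by
    refine Nat.exists_eq_succ_of_ne_zero fun h0 => ?_
    have h1 := Nat.find_spec hex
    rw [h0] at h1
    simp [s, hv] at h1
  have hNs : φ^[N + 1] v ∈ s (N + 1) := hN ▸ Nat.find_spec hex
  have hNn : φ^[N] v ∉ s N := Nat.find_min hex (by omega)
  obtain ⟨b, hb⟩ := Submodule.mem_span_range_iff_exists_fun k |>.1 hNs
  let a : ℕ → k := fun i => if h : i < N + 1 then b ⟨i, h⟩ else 0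
  have ha : ∑ i ∈ Finset.range (N + 1), a i • φ^[i] v = φ^[N + 1] v := by
    rw [← hb, Finset.sum_range]
    exact Finset.sum_congr rfl fun i _ => by simp only [a, dif_pos i.2]
  -- Otherwise `φ^(N+1) v = 0`, against injectivity.
  obtain ⟨j, hj, haj⟩ : ∃ j ≤ N, a j ≠ 0 := by
    by_contra! hall
    have h1 : φ^[N + 1] v = 0 := by
      rw [← ha]
      refine Finset.sum_eq_zero fun i hi => ?_
      rw [hall i (by simpa [Nat.lt_succ_iff] using hi), zero_smul]
    have h2 : φ^[N + 1] (0 : V) = 0 := Function.iterate_fixed (map_zero φ) _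
    exact hv (hinj.iterate (N + 1) (h1.trans h2.symm))
  obtain ⟨x, hx0, hx⟩ := exists_ne_zero_eval_frobeniusIterates hQ a hj haj
  set c : ℕ → k := fun i => (frobeniusIterates Q a i).eval x with hc
  have hc0 : c 0 = x ^ Q * a 0 := by
    simp only [c, frobeniusIterates, Polynomial.eval_mul, Polynomial.eval_C, Polynomial.eval_pow,
      Polynomial.eval_X]
    ring
  have hcs : ∀ i, c (i + 1) = c i ^ Q + x ^ Q * a (i + 1) := fun i => by
    simp only [c, frobeniusIterates, Polynomial.eval_add, Polynomial.eval_mul, Polynomial.eval_C,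
      Polynomial.eval_pow, Polynomial.eval_X]
    ring
  have hcN : c N = x := hx
  refine ⟨∑ i ∈ Finset.range (N + 1), c i • φ^[i] v, ?_, ?_⟩
  · intro h0
    rw [Finset.sum_range_succ, hcN] at h0
    refine hNn ((Submodule.smul_mem_iff _ hx0).1 ?_)
    rw [eq_neg_of_add_eq_zero_right h0]
    exact neg_mem (Submodule.sum_mem _ fun i hi =>
      Submodule.smul_mem _ _ (hmem (Finset.mem_range.1 hi)))
  · rw [map_sum, Finset.sum_range_succ, hsmul, hcN, ← Function.iterate_succ_apply' φ, ← ha,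
      Finset.smul_sum, Finset.sum_range_succ' (fun i => c i • φ^[i] v),
      Finset.sum_range_succ' (fun i => x ^ Q • a i • φ^[i] v), ← add_assoc,
      ← Finset.sum_add_distrib, hc0, mul_smul]
    congr 1
    refine Finset.sum_congr rfl fun i _ => ?_
    rw [hsmul, hcs, add_smul, mul_smul, ← Function.iterate_succ_apply' φ]

/-- A version of Lang's theorem: the fixed vectors of an injective Frobenius-semilinear map on
a finite-dimensional space over an algebraically closed field span the space. -/
theorem span_fixed_of_semilinear {k V : Type*} [Field k] [IsAlgClosed k]
    [AddCommGroup V] [Module k V] [FiniteDimensional k V] {Q : ℕ} (hQ : 2 ≤ Q)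
    (φ : V →+ V) (hsmul : ∀ (c : k) x, φ (c • x) = c ^ Q • φ x)
    (hinj : Function.Injective φ) : Submodule.span k {v | φ v = v} = ⊤ := by
  by_contra hne
  set W := Submodule.span k {v | φ v = v} with hW
  -- `φ` maps `W` onto itself because `k` contains `Q`-th roots; with injectivity this makes the
  -- induced map on `V ⧸ W` injective.
  have hWs : ∀ w ∈ W, ∃ u ∈ W, φ u = w := by
    intro w hw
    induction hw using Submodule.closure_induction with
    | zero => exact ⟨0, W.zero_mem, map_zero φ⟩
    | add x y _ _ hx hy =>
      obtain ⟨u, hu, rfl⟩ := hx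
      obtain ⟨u', hu', rfl⟩ := hy
      exact ⟨u + u', W.add_mem hu hu', map_add _ _ _⟩
    | smul_mem r x hx =>
      obtain ⟨z, hz⟩ := IsAlgClosed.exists_pow_nat_eq r (show 0 < Q by omega)
      refine ⟨z • x, W.smul_mem _ (Submodule.subset_span hx), ?_⟩
      rw [hsmul, hz, hx]
  -- The Lang map `u ↦ u - φ u` is onto `W`; on a multiple of a fixed vector this is the solvability
  -- of `z ^ Q + r = z`. It is used to correct a lift of a fixed vector of `V ⧸ W` to a genuine
  -- fixed vector.
  have hWd : ∀ w ∈ W, ∃ u ∈ W, φ u + w = u := by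
    intro w hw
    induction hw using Submodule.closure_induction with
    | zero => exact ⟨0, W.zero_mem, by simp⟩
    | add x y _ _ hx hy =>
      obtain ⟨u, hu, hux⟩ := hx
      obtain ⟨u', hu', huy⟩ := hy
      refine ⟨u + u', W.add_mem hu hu', ?_⟩
      rw [map_add]
      nth_rw 2 [← hux, ← huy]
      abel
    | smul_mem r x hx =>
      obtain ⟨z, hz⟩ : ∃ z : k, z ^ Q + r = z := by
        obtain ⟨z, hz⟩ := IsAlgClosed.exists_root
          (Polynomial.X ^ Q - Polynomial.X + Polynomial.C r) (by
            intro h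
            have h1 := Polynomial.natDegree_eq_zero_iff_degree_le_zero.2 h.le
            rw [Polynomial.natDegree_add_C, Polynomial.natDegree_sub_eq_left_of_natDegree_lt
              (by simp; omega), Polynomial.natDegree_X_pow] at h1
            omega)
        refine ⟨z, ?_⟩
        have : z ^ Q - z + r = 0 := by simpa [Polynomial.IsRoot] using hz
        linear_combination this
      refine ⟨z • x, W.smul_mem _ (Submodule.subset_span hx), ?_⟩
      rw [hsmul, show φ x = x from hx, ← add_smul, hz]
  have hWφ : ∀ w ∈ W, φ w ∈ W := by
    intro w hw
    induction hw using Submodule.closure_induction with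
    | zero => simp
    | add x y hx hy ihx ihy =>
      rw [map_add]
      exact W.add_mem ihx ihy
    | smul_mem r x hx =>
      rw [hsmul, show φ x = x from hx]
      exact W.smul_mem _ (Submodule.subset_span hx)
  have : Nontrivial (V ⧸ W) := Submodule.Quotient.nontrivial_iff.2 hne
  let φ' : V ⧸ W →+ V ⧸ W := QuotientAddGroup.map W.toAddSubgroup W.toAddSubgroup φ hWφ
  have hφ' : ∀ v : V, φ' (Submodule.Quotient.mk v) = Submodule.Quotient.mk (φ v) := fun v => rfl
  obtain ⟨v', hv0, hv⟩ := exists_ne_zero_fixed_of_semilinear hQ φ'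
    (fun (c : k) (x : V ⧸ W) => by
      obtain ⟨x, rfl⟩ := Submodule.Quotient.mk_surjective W x
      change φ' (Submodule.Quotient.mk (p := W) (c • x)) =
        c ^ Q • φ' (Submodule.Quotient.mk (p := W) x)
      rw [hφ', hφ', hsmul, Submodule.Quotient.mk_smul])
    ((injective_iff_map_eq_zero φ').2 fun x hx => by
      obtain ⟨x, rfl⟩ := Submodule.Quotient.mk_surjective W x
      rw [hφ', Submodule.Quotient.mk_eq_zero] at hx
      obtain ⟨u, hu, hux⟩ := hWs _ hx
      rw [Submodule.Quotient.mk_eq_zero, ← hinj hux]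
      exact hu)
  obtain ⟨v, rfl⟩ := Submodule.Quotient.mk_surjective W v'
  rw [hφ', Submodule.Quotient.eq] at hv
  obtain ⟨u, hu, hue⟩ := hWd _ hv
  refine hv0 ((Submodule.Quotient.mk_eq_zero W).2 ?_)
  have hfix : φ (v + u) = v + u := by
    rw [map_add]
    nth_rw 2 [← hue]
    abel
  have : v + u ∈ W := Submodule.subset_span hfix
  simpa using W.sub_mem this hu

/-! ### Counting Hermitian unit vectors over the field with `q ^ 2` elements -/

/-- A separable polynomial over an algebraically closed field has as many roots as its degree. -/
theorem card_roots_toFinset_of_separable {k : Type*} [Field k] [IsAlgClosed k] [DecidableEq k]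
    {f : Polynomial k} (hf : f.Separable) : f.roots.toFinset.card = f.natDegree := by
  rw [Multiset.toFinset_card_of_nodup (Polynomial.nodup_roots hf)]
  exact (IsAlgClosed.splits f).natDegree_eq_card_roots.symm

theorem exists_finset_pow_sq_eq_self {k : Type*} [Field k] [IsAlgClosed k] {q : ℕ} (hq : 2 ≤ q)
    (hq0 : (q : k) = 0) :
    ∃ E : Finset k, E.card = q ^ 2 ∧ ∀ x, x ∈ E ↔ x ^ q ^ 2 = x := by
  classical
  have h2 : 1 < q ^ 2 := by nlinarith
  let f : Polynomial k := Polynomial.X ^ q ^ 2 - Polynomial.X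
  have hd : f.natDegree = q ^ 2 := by
    rw [Polynomial.natDegree_sub_eq_left_of_natDegree_lt] <;> simp [h2]
  have hsep : f.Separable := by
    refine (IsCoprime.neg_right_iff _ _).1 ?_
    simp [f, Polynomial.derivative_X_pow, hq0, isCoprime_one_right]
  refine ⟨f.roots.toFinset, by rw [card_roots_toFinset_of_separable hsep, hd], fun x => ?_⟩
  have hf0 : f ≠ 0 := by
    intro h; rw [h] at hd; simp at hd; omega
  simp [f, Polynomial.mem_roots hf0, Polynomial.IsRoot, sub_eq_zero]

theorem exists_finset_pow_succ_eq {k : Type*} [Field k] [IsAlgClosed k] {q : ℕ}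
    (hq0 : (q : k) = 0) {c : k} (hc : c ≠ 0) :
    ∃ R : Finset k, R.card = q + 1 ∧ ∀ x, x ∈ R ↔ x ^ (q + 1) = c := by
  classical
  let f : Polynomial k := Polynomial.X ^ (q + 1) - Polynomial.C c
  have hsep : f.Separable := Polynomial.separable_X_pow_sub_C c (by simp [hq0]) hc
  have hf0 : f ≠ 0 := hsep.ne_zero
  refine ⟨f.roots.toFinset, by
    rw [card_roots_toFinset_of_separable hsep, Polynomial.natDegree_X_pow_sub_C], fun x => ?_⟩
  simp [f, Polynomial.mem_roots hf0, Polynomial.IsRoot, sub_eq_zero]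

open Classical in
/-- The vectors with entries in `E` on which the Hermitian form `∑ xᵢ ^ (q + 1)` is one. -/
noncomputable def hermitianUnitVectors {k : Type*} [Field k] (E : Finset k) (q n : ℕ) :
    Finset (Fin n → k) :=
  {x ∈ Fintype.piFinset fun _ => E | ∑ i, x i ^ (q + 1) = 1}

theorem mem_hermitianUnitVectors {k : Type*} [Field k] {E : Finset k} {q n : ℕ}
    {x : Fin n → k} :
    x ∈ hermitianUnitVectors E q n ↔ (∀ i, x i ∈ E) ∧ ∑ i, x i ^ (q + 1) = 1 := by
  classical
  simp [hermitianUnitVectors]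

theorem card_hermitianUnitVectors_le {k : Type*} [Field k] {E : Finset k} {q : ℕ}
    (hE : E.card = q ^ 2) (n : ℕ) : (hermitianUnitVectors E q n).card ≤ q ^ (2 * n) := by
  classical
  refine (Finset.card_filter_le _ _).trans ?_
  simp [hE, pow_mul]

/-- Fibre over the tail `v`. The first coordinate solves `x ^ (q + 1) = c` with `c = 1 - ∑ vᵢ ^ (q +
1)` and `c ^ q = c`: one solution if `c = 0`, otherwise `q + 1`, all lying in `E`. The recursion is
written additively to avoid truncated subtraction. -/
theorem card_hermitianUnitVectors_succ {k : Type*} [Field k] [IsAlgClosed k] {q : ℕ}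
    (hq : 2 ≤ q) (σ : k →+* k) (hσ : ∀ x, σ x = x ^ q) (hq0 : (q : k) = 0)
    {E : Finset k} (hE : E.card = q ^ 2) (hEm : ∀ x, x ∈ E ↔ x ^ q ^ 2 = x) (n : ℕ) :
    (hermitianUnitVectors E q (n + 1)).card + q * (hermitianUnitVectors E q n).card =
      (q + 1) * q ^ (2 * n) := by
  classical
  set P : Finset (Fin n → k) := Fintype.piFinset fun _ => E with hP
  have hPc : P.card = q ^ (2 * n) := by simp [P, hE, pow_mul]
  have hfib : ∀ v ∈ P, ({x ∈ hermitianUnitVectors E q (n + 1) | Fin.tail x = v}).card =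
      if ∑ i, v i ^ (q + 1) = 1 then 1 else q + 1 := by
    intro v hv
    have hvE : ∀ i, v i ^ q ^ 2 = v i := fun i => (hEm _).1 (Fintype.mem_piFinset.1 hv i)
    have hfix : (∑ i, v i ^ (q + 1)) ^ q = ∑ i, v i ^ (q + 1) := by
      rw [← hσ, map_sum]
      refine Finset.sum_congr rfl fun i _ => ?_
      rw [hσ, ← pow_mul, show (q + 1) * q = q ^ 2 + q by ring, pow_add, hvE]
      ring
    have himg : {x ∈ hermitianUnitVectors E q (n + 1) | Fin.tail x = v} =
        {x ∈ E | x ^ (q + 1) = 1 - ∑ i, v i ^ (q + 1)}.image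
          (fun x => (Fin.cons x v : Fin (n + 1) → k)) := by
      ext x
      simp only [Finset.mem_filter, mem_hermitianUnitVectors, Finset.mem_image, Fin.sum_univ_succ]
      constructor
      · rintro ⟨⟨h1, h2⟩, rfl⟩
        exact ⟨x 0, ⟨h1 0, by rw [← h2]; simp [Fin.tail]⟩, Fin.cons_self_tail x⟩
      · rintro ⟨x, ⟨h1, h2⟩, rfl⟩
        refine ⟨⟨fun i => ?_, by simp [h2]⟩, Fin.tail_cons _ _⟩
        refine Fin.cases ?_ (fun i => ?_) i
        · simpa using h1
        · simpa using Fintype.mem_piFinset.1 hv i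
    rw [himg, Finset.card_image_of_injective _ fun x y h => (Fin.cons_inj.1 h).1]
    split_ifs with h
    · rw [h, sub_self, Finset.card_eq_one]
      refine ⟨0, ?_⟩
      ext x
      simp only [Finset.mem_filter, Finset.mem_singleton, hEm]
      constructor
      · rintro ⟨-, h⟩
        exact pow_eq_zero_iff (by omega) |>.1 h
      · rintro rfl
        exact ⟨zero_pow (by positivity), zero_pow (by omega)⟩
    · set c := 1 - ∑ i, v i ^ (q + 1) with hc
      have hc0 : c ≠ 0 := fun h0 => h (sub_eq_zero.1 h0).symm
      have hcq : c ^ q = c := by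
        rw [hc, ← hσ, map_sub, map_one, hσ, hfix]
      obtain ⟨R, hR, hRm⟩ := exists_finset_pow_succ_eq hq0 hc0
      suffices heq : {x ∈ E | x ^ (q + 1) = c} = R by rw [heq, hR]
      ext x
      simp only [Finset.mem_filter, hEm, hRm, and_iff_right_iff_imp]
      intro hx
      have hx0 : x ≠ 0 := by
        rintro rfl
        rw [zero_pow (by omega)] at hx
        exact hc0 hx.symm
      -- Both sides equal `c`, the left one because `c ^ q = c`; cancelling `x ^ q` puts `x` in `E`.
      have h1 : x ^ q ^ 2 * x ^ q = x ^ q * x := by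
        rw [← pow_add, ← pow_succ, hx, ← hcq, ← hx, ← pow_mul]
        congr 1
        ring
      have h3 : x ^ q ≠ 0 := pow_ne_zero _ hx0
      exact mul_right_cancel₀ h3 (h1.trans (mul_comm _ _))
  rw [Finset.card_eq_sum_card_fiberwise (f := Fin.tail) (t := P)
    (fun x hx => Fintype.mem_piFinset.2 fun i => (mem_hermitianUnitVectors.1 hx).1 (Fin.succ i)),
    Finset.sum_congr rfl hfib, Finset.sum_ite, Finset.sum_const, Finset.sum_const]
  have h1 : {x ∈ P | ∑ i, x i ^ (q + 1) = 1} = hermitianUnitVectors E q n := by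
    ext x
    simp [P, mem_hermitianUnitVectors]
  have h2 := Finset.card_filter_add_card_filter_not (s := P) (fun x => ∑ i, x i ^ (q + 1) = 1)
  rw [h1, hPc] at h2
  rw [h1, ← h2, smul_eq_mul, smul_eq_mul]
  ring

theorem card_hermitianUnitVectors_succ_pos {k : Type*} [Field k] [IsAlgClosed k] {q : ℕ}
    (hq : 2 ≤ q) (σ : k →+* k) (hσ : ∀ x, σ x = x ^ q) (hq0 : (q : k) = 0)
    {E : Finset k} (hE : E.card = q ^ 2) (hEm : ∀ x, x ∈ E ↔ x ^ q ^ 2 = x) (n : ℕ) :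
    0 < (hermitianUnitVectors E q (n + 1)).card := by
  have h1 := card_hermitianUnitVectors_succ hq σ hσ hq0 hE hEm n
  have h2 := card_hermitianUnitVectors_le hE n
  have h3 : 0 < q ^ (2 * n) := by positivity
  nlinarith

/-! ### Orthonormal frames of nondegenerate sesquilinear forms -/

section Sesquilinear

universe u

variable {k : Type*} [Field k] {q : ℕ} {σ : k →+* k}

/-- A family of vectors that is orthonormal for a sesquilinear form. -/
def IsOrthonormalFamily {V : Type*} [AddCommGroup V] [Module k V]
    (β : V →ₛₗ[σ] V →ₗ[k] k) {n : ℕ} (f : Fin n → V) : Prop :=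
  ∀ i j, β (f i) (f j) = if i = j then 1 else 0

theorem IsOrthonormalFamily.apply_sum {V : Type*} [AddCommGroup V] [Module k V]
    {β : V →ₛₗ[σ] V →ₗ[k] k} {n : ℕ} {f : Fin n → V} (hf : IsOrthonormalFamily β f)
    (i : Fin n) (c : Fin n → k) : β (f i) (∑ j, c j • f j) = c i := by
  simp [hf i]

theorem IsOrthonormalFamily.linearIndependent {V : Type*} [AddCommGroup V] [Module k V]
    {β : V →ₛₗ[σ] V →ₗ[k] k} {n : ℕ} {f : Fin n → V} (hf : IsOrthonormalFamily β f) :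
    LinearIndependent k f := by
  rw [Fintype.linearIndependent_iff]
  intro g hg i
  rw [← hf.apply_sum i g, hg, map_zero]

/-- The rule `β(y, φ v) = β(v, y) ^ q` defines an injective `q ^ 2`-semilinear map `φ`, and its
fixed vectors satisfy the Hermitian symmetry against every `y`. They span `V`, so by polarization
they cannot all be isotropic, and an anisotropic one can be rescaled. The symmetry is kept in the
conclusion so that left and right orthogonality to `v` agree. -/
theorem exists_hermitian_unit [IsAlgClosed k] {V : Type*} [AddCommGroup V] [Module k V]
    [FiniteDimensional k V] [Nontrivial V] (hq : 2 ≤ q) (hσ : ∀ x, σ x = x ^ q) (β : V →ₛₗ[σ] V →ₗ[k] k)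
    (hl : ∀ v, (∀ y, β v y = 0) → v = 0) (hr : ∀ v, (∀ y, β y v = 0) → v = 0) :
    ∃ v, β v v = 1 ∧ ∀ y, β v y ^ q = β y v := by
  have hex : ∀ v, ∃ w, ∀ y, β y w = β v y ^ q := by
    intro v
    let b := Module.finBasis k V
    let Φ : V →ₗ[k] (Fin (Module.finrank k V) → k) := LinearMap.pi fun i => β (b i)
    have hΦ : Function.Injective Φ := by
      refine (injective_iff_map_eq_zero Φ).2 fun w hw => hr w fun y => ?_
      rw [← b.sum_repr y, map_sum, LinearMap.sum_apply]
      refine Finset.sum_eq_zero fun i _ => ?_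
      have : β (b i) w = 0 := congrFun hw i
      simp [LinearMap.map_smulₛₗ, this]
    obtain ⟨w, hw⟩ := (LinearMap.injective_iff_surjective_of_finrank_eq_finrank
      (by simp)).1 hΦ (fun i => β v (b i) ^ q)
    refine ⟨w, fun y => ?_⟩
    have hw' : ∀ i, β (b i) w = σ (β v (b i)) := fun i => (congrFun hw i).trans (hσ _).symm
    rw [← hσ, ← b.sum_repr y, map_sum, LinearMap.sum_apply, map_sum, map_sum]
    refine Finset.sum_congr rfl fun i _ => ?_
    simp [LinearMap.map_smulₛₗ, hw']
  choose ψ hψ using hex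
  have hunique : ∀ {w w' : V}, (∀ y, β y w = β y w') → w = w' := fun {w w'} h =>
    sub_eq_zero.1 (hr _ fun y => by rw [map_sub, h, sub_self])
  let φ : V →+ V := AddMonoidHom.mk' ψ fun x z => hunique fun y => by
    simp only [hψ, map_add, LinearMap.add_apply, ← hσ]
  have hφ : ∀ v y, β y (φ v) = β v y ^ q := hψ
  have hsmul : ∀ (c : k) x, φ (c • x) = c ^ q ^ 2 • φ x := fun c x => hunique fun y => by
    rw [hφ, (β y).map_smul, hφ, β.map_smulₛₗ, hσ, LinearMap.smul_apply, smul_eq_mul,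
      smul_eq_mul, mul_pow, ← pow_mul, sq]
  have hinj : Function.Injective φ := (injective_iff_map_eq_zero φ).2 fun v hv => hl v fun y => by
    have h1 := hφ v y
    rw [hv, map_zero] at h1
    exact pow_eq_zero_iff (by omega) |>.1 h1.symm
  have hspan := span_fixed_of_semilinear (by nlinarith : 2 ≤ q ^ 2) φ hsmul hinj
  have hherm : ∀ v, φ v = v → ∀ y, β v y ^ q = β y v := fun v hv y => by rw [← hφ, hv]
  obtain ⟨v, hv, hv0⟩ : ∃ v, φ v = v ∧ β v v ≠ 0 := by
    by_contra! hiso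
    have hall : ∀ u v, φ u = u → φ v = v → β u v = 0 := by
      intro u v hu hv
      by_contra hb
      -- For `s = t / β(u, v)` the vector `u + s v` is again fixed, since `t ^ q ^ 2 = t`, and its
      -- value under `β` is `t + t ^ q = 1`, contradicting isotropy.
      obtain ⟨t, ht⟩ : ∃ t : k, t + t ^ q = 1 := by
        obtain ⟨z, hz⟩ := IsAlgClosed.exists_root
          (Polynomial.X ^ q + Polynomial.X - Polynomial.C (1 : k)) (by
            intro h
            have h1 := Polynomial.natDegree_eq_zero_iff_degree_le_zero.2 h.le
            rw [Polynomial.natDegree_sub_C, Polynomial.natDegree_add_eq_left_of_natDegree_lt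
              (by simp; omega), Polynomial.natDegree_X_pow] at h1
            omega)
        refine ⟨z, ?_⟩
        have : z ^ q + z - 1 = 0 := by simpa [Polynomial.IsRoot] using hz
        linear_combination this
      have ht2 : t ^ q ^ 2 = t := by
        have h1 : t ^ q = 1 - t := by linear_combination ht
        rw [sq, pow_mul, h1, ← hσ, map_sub, map_one, hσ, h1]
        ring
      have hb2 : β u v ^ q ^ 2 = β u v := by
        rw [sq, pow_mul, hherm u hu v, hherm v hv u]
      set s := t / β u v with hs
      have hs2 : s ^ q ^ 2 = s := by rw [hs, div_pow, ht2, hb2]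
      have hfix : φ (u + s • v) = u + s • v := by rw [map_add, hsmul, hs2, hu, hv]
      have h1 := hiso _ hfix
      have hsb : s * β u v = t := div_mul_cancel₀ _ hb
      simp only [map_add, LinearMap.add_apply, LinearMap.map_smulₛₗ, LinearMap.smul_apply,
        smul_eq_mul, RingHom.id_apply, hiso u hu, hiso v hv, hσ, ← hherm u hu v] at h1
      rw [← mul_pow, mul_add, hsb] at h1
      refine one_ne_zero (α := k) ?_
      linear_combination h1 - ht
    obtain ⟨v, hv⟩ := exists_ne (0 : V)
    have hzero : ∀ u, φ u = u → u = 0 := by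
      intro u hu
      refine hl u fun y => ?_
      have hy : y ∈ Submodule.span k {v | φ v = v} := hspan ▸ Submodule.mem_top
      have hle : Submodule.span k {v | φ v = v} ≤ LinearMap.ker (β u) :=
        Submodule.span_le.2 fun v hv => hall u v hu hv
      exact hle hy
    have hbot : Submodule.span k {v | φ v = v} = ⊥ := Submodule.span_eq_bot.2 hzero
    exact top_ne_bot (hspan.symm.trans hbot)
  set b := β v v with hb
  have hbq : b ^ q = b := hherm v hv v
  -- Rescaling by `z` multiplies `b` by `z ^ (q + 1)`; as `b ^ q = b`, also `z ^ q ^ 2 = z`, so `z •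
  -- v` stays fixed.
  obtain ⟨z, hz⟩ := IsAlgClosed.exists_pow_nat_eq b⁻¹ (show 0 < q + 1 by omega)
  have hz0 : z ≠ 0 := by
    rintro rfl
    rw [zero_pow (by omega)] at hz
    exact inv_ne_zero hv0 hz.symm
  have hz2 : z ^ q ^ 2 = z := by
    have h1 : z ^ q ^ 2 * z ^ q = z ^ q * z := by
      have h2 : (b⁻¹) ^ q = b⁻¹ := by rw [inv_pow, hbq]
      rw [← pow_add, ← pow_succ, hz, ← h2, ← hz, ← pow_mul]
      congr 1
      ring
    exact mul_right_cancel₀ (pow_ne_zero q hz0) (h1.trans (mul_comm _ _))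
  refine ⟨z • v, ?_, hherm _ (by rw [hsmul, hz2, hv])⟩
  rw [β.map_smulₛₗ, LinearMap.smul_apply, (β v).map_smul, hσ, ← hb, smul_eq_mul, smul_eq_mul,
    ← mul_assoc, ← pow_succ, hz, inv_mul_cancel₀ hv0]

/-- A nondegenerate sesquilinear form on an `n`-dimensional space has at least as many orthonormal
families of length `n` as the standard Hermitian form over the field with `q ^ 2` elements. -/
theorem exists_finset_isOrthonormalFamily [IsAlgClosed k] (hq : 2 ≤ q) (hσ : ∀ x, σ x = x ^ q)
    (hq0 : (q : k) = 0) {E : Finset k} (hE : E.card = q ^ 2) (hEm : ∀ x, x ∈ E ↔ x ^ q ^ 2 = x)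
    (n : ℕ) : ∀ (V : Type u) [AddCommGroup V] [Module k V] [FiniteDimensional k V]
    (β : V →ₛₗ[σ] V →ₗ[k] k), (∀ v, (∀ y, β v y = 0) → v = 0) →
    (∀ v, (∀ y, β y v = 0) → v = 0) → Module.finrank k V = n →
    ∃ S : Finset (Fin n → V), (∀ f ∈ S, IsOrthonormalFamily β f) ∧
      ∏ i ∈ Finset.range n, (hermitianUnitVectors E q (i + 1)).card ≤ S.card := by
  classical
  induction n with
  | zero =>
    intro V _ _ _ β _ _ _
    exact ⟨{Fin.elim0}, fun f _ i => i.elim0, by simp⟩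
  | succ n ih =>
    intro V _ _ _ β hl hr hV
    -- A Hermitian unit vector splits off: its kernel `W` is orthogonal to it on both sides, so `β`
    -- stays nondegenerate on `W` and induction applies there.
    have hstep : ∀ v, β v v = 1 → (∀ y, β v y ^ q = β y v) → ∃ S : Finset (Fin n → V),
        (∀ f ∈ S, IsOrthonormalFamily β (Fin.cons v f : Fin (n + 1) → V)) ∧
        ∏ i ∈ Finset.range n, (hermitianUnitVectors E q (i + 1)).card ≤ S.card := by
      intro v hv hherm
      set W := LinearMap.ker (β v) with hW
      have hperp : ∀ w ∈ W, β v w = 0 ∧ β w v = 0 := fun w hw => by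
        have h1 : β v w = 0 := hw
        exact ⟨h1, by rw [← hherm, h1, zero_pow (by omega)]⟩
      have hdec : ∀ y, y - β v y • v ∈ W := fun y => by
        rw [hW, LinearMap.mem_ker, map_sub, (β v).map_smul, hv, smul_eq_mul, mul_one, sub_self]
      obtain ⟨S, hS, hSc⟩ := ih W (β.domRestrict₁₂ W W)
        (fun w hw => by
          refine Subtype.ext (hl w fun y => ?_)
          have h1 : β w (y - β v y • v) = 0 := hw ⟨_, hdec y⟩
          rwa [map_sub, (β w).map_smul, (hperp w w.2).2, smul_zero, sub_zero] at h1)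
        (fun w hw => by
          refine Subtype.ext (hr w fun y => ?_)
          have h1 : β (y - β v y • v) w = 0 := hw ⟨_, hdec y⟩
          rwa [map_sub, LinearMap.sub_apply, β.map_smulₛₗ, LinearMap.smul_apply,
            (hperp w w.2).1, smul_zero, sub_zero] at h1)
        (by
          have h1 := Module.Dual.finrank_ker_add_one_of_ne_zero (K := k) (f := β v) (by
            intro h0
            rw [h0] at hv
            exact zero_ne_one hv)
          rw [hV] at h1
          exact Nat.succ_injective h1)
      refine ⟨S.image fun f i => (f i : V), ?_, ?_⟩
      · intro f hf
        obtain ⟨g, hg, rfl⟩ := Finset.mem_image.1 hf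
        intro i j
        refine Fin.cases ?_ (fun i => ?_) i <;> refine Fin.cases ?_ (fun j => ?_) j
        · simp [hv]
        · simp [(hperp _ (g j).2).1, (Fin.succ_ne_zero _).symm]
        · simpa [Fin.succ_ne_zero] using (hperp _ (g i).2).2
        · simpa only [Fin.cons_succ, Fin.succ_inj] using! hS g hg i j
      · rwa [Finset.card_image_of_injective _ fun f g h =>
          funext fun i => Subtype.ext (congrFun h i)]
    have : Nontrivial V := Module.nontrivial_of_finrank_pos (R := k) (by omega)
    obtain ⟨v, hv, hherm⟩ := exists_hermitian_unit hq hσ β hl hr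
    obtain ⟨S, hS, hSc⟩ := hstep v hv hherm
    obtain ⟨f, hf⟩ : S.Nonempty := by
      refine Finset.card_pos.1 (lt_of_lt_of_le (Finset.prod_pos fun i _ => ?_) hSc)
      exact card_hermitianUnitVectors_succ_pos hq σ hσ hq0 hE hEm i
    -- One orthonormal basis suffices to produce many first vectors: combinations of `b` with
    -- coefficients in `hermitianUnitVectors E q (n + 1)` are again Hermitian unit vectors, and
    -- `hstep` extends each of them.
    set b : Fin (n + 1) → V := Fin.cons v f with hb
    have hbo : IsOrthonormalFamily β b := hS f hf
    have hspan : Submodule.span k (Set.range b) = ⊤ :=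
      hbo.linearIndependent.span_eq_top_of_card_eq_finrank (by simp [hV])
    set w : (Fin (n + 1) → k) → V := fun x => ∑ i, x i • b i with hw
    have hwy : ∀ x c, β (w x) (w c) = ∑ i, x i ^ q * c i := by
      intro x c
      rw [hw]
      simp only [map_sum β, LinearMap.sum_apply, LinearMap.map_smulₛₗ, LinearMap.smul_apply, hσ,
        smul_eq_mul]
      exact Finset.sum_congr rfl fun i _ => by rw [← hbo.apply_sum i c, map_sum]
    have hwit : ∀ x ∈ hermitianUnitVectors E q (n + 1), ∃ S : Finset (Fin n → V),
        (∀ f ∈ S, IsOrthonormalFamily β (Fin.cons (w x) f : Fin (n + 1) → V)) ∧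
        ∏ i ∈ Finset.range n, (hermitianUnitVectors E q (i + 1)).card ≤ S.card := by
      intro x hx
      rw [mem_hermitianUnitVectors] at hx
      refine hstep _ ?_ fun y => ?_
      · rw [hwy, ← hx.2]
        exact Finset.sum_congr rfl fun i _ => (pow_succ _ _).symm
      · obtain ⟨c, rfl⟩ := (Submodule.mem_span_range_iff_exists_fun k).1
          (hspan ▸ Submodule.mem_top : y ∈ Submodule.span k (Set.range b))
        change β (w x) (w c) ^ q = β (w c) (w x)
        rw [hwy, hwy, ← hσ, map_sum]
        refine Finset.sum_congr rfl fun i _ => ?_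
        rw [hσ, mul_pow, ← pow_mul, ← sq, (hEm _).1 (hx.1 i), mul_comm]
    choose! F hF hFc using hwit
    refine ⟨((hermitianUnitVectors E q (n + 1)).sigma F).image
      fun z => (Fin.cons (w z.1) z.2 : Fin (n + 1) → V), ?_, ?_⟩
    · intro g hg
      obtain ⟨⟨x, f⟩, hz, rfl⟩ := Finset.mem_image.1 hg
      rw [Finset.mem_sigma] at hz
      exact hF x hz.1 f hz.2
    · have hwinj : Function.Injective w := fun x c h => funext fun i => by
        rw [← hbo.apply_sum i x, ← hbo.apply_sum i c]
        exact congrArg (β (b i)) h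
      rw [Finset.card_image_of_injective, Finset.card_sigma, Finset.prod_range_succ, mul_comm]
      · exact Finset.card_nsmul_le_sum _ _ _ fun x hx => hFc x hx
      · rintro ⟨x, f⟩ ⟨c, g⟩ h
        have h1 := Fin.cons_inj.1 h
        obtain rfl := hwinj h1.1
        obtain rfl : f = g := h1.2
        rfl

end Sesquilinear

/-! ### Lines on the surface and the doubles built from two quadrics -/

section Rulings

variable {k : Type*} [Field k] {q : ℕ} {e : Fin 4 → Fin 4 → k} {a b a' b' r r' : k}

/-- In the coordinates of a frame `e`, the plane with equations `x₀ = a x₂`, `x₃ = b x₁`. -/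
def rulingPlane (e : Fin 4 → Fin 4 → k) (a b : k) : Submodule k (Fin 4 → k) :=
  Submodule.span k {a • e 0 + e 2, e 1 + b • e 3}

/-- The frame with its last two vectors exchanged. -/
def twist {V : Type*} (e : Fin 4 → V) : Fin 4 → V := ![e 0, e 1, e 3, e 2]

theorem twist_twist {V : Type*} (e : Fin 4 → V) : twist (twist e) = e := by
  funext i
  fin_cases i <;> rfl

theorem twist_eq_comp_swap {V : Type*} (e : Fin 4 → V) : twist e = e ∘ Equiv.swap 2 3 := by
  funext i
  fin_cases i <;> rfl

theorem LinearIndependent.twist (he : LinearIndependent k e) :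
    LinearIndependent k (twist e) := by
  rw [twist_eq_comp_swap]
  exact he.comp _ (Equiv.injective _)

theorem mem_rulingPlane {x : Fin 4 → k} :
    x ∈ rulingPlane e a b ↔
      ∃ s t, x = Fintype.linearCombination k e ![s * a, t, s, t * b] := by
  rw [rulingPlane, Submodule.mem_span_pair]
  refine exists_congr fun s => exists_congr fun t => ?_
  rw [eq_comm]
  simp [Fintype.linearCombination_apply, Fin.sum_univ_four, mul_smul]
  refine Eq.congr_right ?_
  abel

theorem mem_rulingPlane_twist {x : Fin 4 → k} :
    x ∈ rulingPlane (twist e) a b ↔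
      ∃ s t, x = Fintype.linearCombination k e ![s * a, t, t * b, s] := by
  rw [mem_rulingPlane]
  refine exists_congr fun s => exists_congr fun t => Eq.congr_right ?_
  simp [Fintype.linearCombination_apply, Fin.sum_univ_four, twist]
  abel

theorem linearCombination_injective (he : LinearIndependent k e) :
    Function.Injective (Fintype.linearCombination k e) :=
  LinearIndependent.fintypeLinearCombination_injective he

theorem finrank_rulingPlane (he : LinearIndependent k e) (a b : k) :
    Module.finrank k (rulingPlane e a b) = 2 := by
  have hli : LinearIndependent k ![a • e 0 + e 2, e 1 + b • e 3] := by
    rw [LinearIndependent.pair_iff]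
    intro s t h
    have h1 : Fintype.linearCombination k e ![s * a, t, s, t * b] =
        Fintype.linearCombination k e 0 := by
      rw [map_zero, ← h]
      simp [Fintype.linearCombination_apply, Fin.sum_univ_four, mul_smul]
      abel
    have h2 := linearCombination_injective he h1
    exact ⟨by simpa using congrFun h2 2, by simpa using congrFun h2 1⟩
  have := finrank_span_eq_card hli
  rwa [Matrix.range_cons, Matrix.range_cons, Matrix.range_empty, Set.union_empty,
    Set.singleton_union, Fintype.card_fin] at this

/-- The line with equations `x₀ = a x₂`, `x₃ = b x₁` in the coordinates of a frame. -/
def rulingLine (he : LinearIndependent k e) (a b : k) : ProjLine k :=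
  ⟨rulingPlane e a b, finrank_rulingPlane he a b⟩

theorem ProjLine.Skew.symm {l m : ProjLine k} (h : l.Skew m) : m.Skew l := by
  rw [ProjLine.Skew, inf_comm]
  exact h

theorem rulingLine_skew_iff (he : LinearIndependent k e) :
    (rulingLine he a b).Skew (rulingLine he a' b') ↔ a ≠ a' ∧ b ≠ b' := by
  rw [ProjLine.Skew, Submodule.eq_bot_iff]
  constructor
  · intro h
    constructor
    · rintro rfl
      have h1 := h (Fintype.linearCombination k e ![a, 0, 1, 0])
        ⟨mem_rulingPlane.2 ⟨1, 0, by simp⟩, mem_rulingPlane.2 ⟨1, 0, by simp⟩⟩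
      have h2 := linearCombination_injective he (h1.trans (map_zero _).symm)
      simpa using congrFun h2 2
    · rintro rfl
      have h1 := h (Fintype.linearCombination k e ![0, 1, 0, b])
        ⟨mem_rulingPlane.2 ⟨0, 1, by simp⟩, mem_rulingPlane.2 ⟨0, 1, by simp⟩⟩
      have h2 := linearCombination_injective he (h1.trans (map_zero _).symm)
      simpa using congrFun h2 1
  · rintro ⟨ha, hb⟩ x ⟨hx, hx'⟩
    obtain ⟨s, t, rfl⟩ := mem_rulingPlane.1 hx
    obtain ⟨s', t', h⟩ := mem_rulingPlane.1 hx'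
    have h1 := linearCombination_injective he h
    have e0 : s * a = s' * a' := congrFun h1 0
    have e1 : t = t' := congrFun h1 1
    have e2 : s = s' := congrFun h1 2
    have e3 : t * b = t' * b' := congrFun h1 3
    subst e1 e2
    obtain rfl : s = 0 := by
      by_contra h0
      exact ha (mul_left_cancel₀ h0 e0)
    obtain rfl : t = 0 := by
      by_contra h0
      exact hb (mul_left_cancel₀ h0 e3)
    rw [← map_zero (Fintype.linearCombination k e)]
    congr 1
    funext i
    fin_cases i <;> simp

theorem rulingLine_skew_twist_iff (he : LinearIndependent k e) :
    (rulingLine he a b).Skew (rulingLine he.twist a' b') ↔ a * b' ≠ a' * b := by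
  rw [ProjLine.Skew, Submodule.eq_bot_iff]
  constructor
  · intro h hab
    have h1 := h (Fintype.linearCombination k e ![a * b', 1, b', b])
      ⟨mem_rulingPlane.2 ⟨b', 1, by simp [mul_comm]⟩,
        mem_rulingPlane_twist.2 ⟨b, 1, by simp [hab, mul_comm]⟩⟩
    have h2 := linearCombination_injective he (h1.trans (map_zero _).symm)
    simpa using congrFun h2 1
  · rintro hab x ⟨hx, hx'⟩
    obtain ⟨s, t, rfl⟩ := mem_rulingPlane.1 hx
    obtain ⟨s', t', h⟩ := mem_rulingPlane_twist.1 hx'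
    have h1 := linearCombination_injective he h
    have e0 : s * a = s' * a' := congrFun h1 0
    have e1 : t = t' := congrFun h1 1
    have e2 : s = t' * b' := congrFun h1 2
    have e3 : t * b = s' := congrFun h1 3
    subst e1 e2 e3
    obtain rfl : t = 0 := by
      by_contra h0
      exact hab (mul_left_cancel₀ h0 (by linear_combination e0))
    rw [← map_zero (Fintype.linearCombination k e)]
    congr 1
    funext i
    fin_cases i <;> simp

theorem rulingLine_ne_twist (he : LinearIndependent k e) :
    rulingLine he a b ≠ rulingLine he.twist a' b' := by
  intro h
  have h1 : rulingPlane e a b = rulingPlane (twist e) a' b' := congrArg Subtype.val h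
  have h2 : Fintype.linearCombination k e ![a, 0, 1, 0] ∈ rulingPlane (twist e) a' b' :=
    h1 ▸ mem_rulingPlane.2 ⟨1, 0, by simp⟩
  obtain ⟨s, t, h3⟩ := mem_rulingPlane_twist.1 h2
  have h4 := linearCombination_injective he h3
  have e1 : 0 = t := congrFun h4 1
  have e2 : 1 = t * b' := congrFun h4 2
  rw [← e1, zero_mul] at e2
  exact one_ne_zero e2

theorem rulingLine_inj (he : LinearIndependent k e) :
    rulingLine he a b = rulingLine he a' b' ↔ a = a' ∧ b = b' := by
  refine ⟨fun h => ?_, by rintro ⟨rfl, rfl⟩; rfl⟩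
  have h1 : rulingPlane e a b = rulingPlane e a' b' := congrArg Subtype.val h
  have h2 : Fintype.linearCombination k e ![a, 1, 1, b] ∈ rulingPlane e a' b' :=
    h1 ▸ mem_rulingPlane.2 ⟨1, 1, by simp⟩
  obtain ⟨s, t, h3⟩ := mem_rulingPlane.1 h2
  have h4 := linearCombination_injective he h3
  have e0 : a = s * a' := congrFun h4 0
  have e1 : 1 = t := congrFun h4 1
  have e2 : 1 = s := congrFun h4 2
  have e3 : b = t * b' := congrFun h4 3
  rw [e0, e3, ← e1, ← e2]
  simp

/-- The `q + 1` lines on the Hermitian surface that form one ruling of the quadric with equation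
`x₀ x₁ r = x₂ x₃` in the coordinates of an orthonormal frame. -/
def ruling (q : ℕ) (e : Fin 4 → Fin 4 → k) (r : k) : Set (ProjLine k) :=
  {l | ∃ a, a ^ (q + 1) = -1 ∧ l.1 = rulingPlane e a (r * a)}

theorem mem_ruling (he : LinearIndependent k e) {l : ProjLine k} :
    l ∈ ruling q e r ↔ ∃ a, a ^ (q + 1) = -1 ∧ l = rulingLine he a (r * a) :=
  exists_congr fun _ => and_congr_right fun _ => (Subtype.ext_iff (a2 := rulingLine he _ _)).symm

theorem encard_ruling (he : LinearIndependent k e)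
    (hT : {a : k | a ^ (q + 1) = -1}.encard = (q + 1 : ℕ)) (r : k) :
    (ruling q e r).encard = (q + 1 : ℕ) := by
  have h : ruling q e r = (fun a => rulingLine he a (r * a)) '' {a : k | a ^ (q + 1) = -1} := by
    ext l
    rw [mem_ruling he]
    exact exists_congr fun a => and_congr_right fun _ => eq_comm
  rw [h, Function.Injective.encard_image, hT]
  exact fun a b hab => ((rulingLine_inj he).1 hab).1

theorem disjoint_ruling_twist (he : LinearIndependent k e) (r r' : k) :
    Disjoint (ruling q e r) (ruling q (twist e) r') := by
  refine Set.disjoint_left.2 fun l hl hl' => ?_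
  obtain ⟨a, -, rfl⟩ := (mem_ruling he).1 hl
  obtain ⟨b, -, h⟩ := (mem_ruling he.twist).1 hl'
  exact rulingLine_ne_twist he h

theorem ne_zero_of_pow_succ_eq_one (hr : r ^ (q + 1) = 1) : r ≠ 0 := by
  rintro rfl
  rw [zero_pow (by omega)] at hr
  exact zero_ne_one hr

theorem ne_zero_of_pow_succ_eq_neg_one (ha : a ^ (q + 1) = -1) : a ≠ 0 := by
  rintro rfl
  rw [zero_pow (by omega)] at ha
  exact neg_ne_zero.2 one_ne_zero ha.symm

theorem not_skew_of_mem_ruling (he : LinearIndependent k e) {l m : ProjLine k}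
    (hl : l ∈ ruling q e r) (hm : m ∈ ruling q (twist e) r) : ¬ l.Skew m := by
  obtain ⟨a, -, rfl⟩ := (mem_ruling he).1 hl
  obtain ⟨b, -, rfl⟩ := (mem_ruling he.twist).1 hm
  rw [rulingLine_skew_twist_iff, not_not]
  ring

/-- For parameters `a`, `b` the incidence condition is `a (r' b) = b (r a)`; since `a`, `b` are
nonzero it forces `r = r'`. -/
theorem skew_of_mem_ruling_twist (he : LinearIndependent k e) (hrr : r ≠ r') {l m : ProjLine k}
    (hl : l ∈ ruling q e r) (hm : m ∈ ruling q (twist e) r') : l.Skew m := by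
  obtain ⟨a, ha, rfl⟩ := (mem_ruling he).1 hl
  obtain ⟨b, hb, rfl⟩ := (mem_ruling he.twist).1 hm
  rw [rulingLine_skew_twist_iff]
  intro h
  refine hrr (mul_left_cancel₀ (mul_ne_zero (ne_zero_of_pow_succ_eq_neg_one ha)
    (ne_zero_of_pow_succ_eq_neg_one hb)) ?_)
  linear_combination -h

theorem skew_of_mem_ruling (he : LinearIndependent k e) (hr : r ^ (q + 1) = 1)
    {l m : ProjLine k} (hl : l ∈ ruling q e r) (hm : m ∈ ruling q e r) (hlm : l ≠ m) :
    l.Skew m := by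
  obtain ⟨a, -, rfl⟩ := (mem_ruling he).1 hl
  obtain ⟨b, -, rfl⟩ := (mem_ruling he).1 hm
  rw [rulingLine_skew_iff]
  have hab : a ≠ b := by
    rintro rfl
    exact hlm rfl
  exact ⟨hab, fun h => hab (mul_left_cancel₀ (ne_zero_of_pow_succ_eq_one hr) h)⟩

/-- Lines with parameters `a` and `b` meet iff `a = b` or `r a = r' b`. Both `a` and `r a / r'` are
admissible parameters, and they differ since `r ≠ r'`. -/
theorem encard_meets_ruling (he : LinearIndependent k e) (hr : r ^ (q + 1) = 1)
    (hr' : r' ^ (q + 1) = 1) (hrr : r ≠ r') {l : ProjLine k} (hl : l ∈ ruling q e r) :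
    {m ∈ ruling q e r' | ¬ l.Skew m}.encard = 2 := by
  obtain ⟨a, ha, rfl⟩ := (mem_ruling he).1 hl
  have ha0 := ne_zero_of_pow_succ_eq_neg_one ha
  have hr0 := ne_zero_of_pow_succ_eq_one hr'
  have h : {m ∈ ruling q e r' | ¬ (rulingLine he a (r * a)).Skew m} =
      {rulingLine he a (r' * a), rulingLine he (r * a / r') (r * a)} := by
    ext m
    simp only [Set.mem_ofPred_eq, Set.mem_insert_iff, Set.mem_singleton_iff, mem_ruling he]
    constructor
    · rintro ⟨⟨b, hb, rfl⟩, hskew⟩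
      rw [rulingLine_skew_iff, not_and_or, not_not, not_not] at hskew
      rcases hskew with rfl | h
      · exact Or.inl rfl
      · right
        rw [rulingLine_inj]
        exact ⟨by rw [h]; field_simp, h.symm⟩
    · rintro (rfl | rfl)
      · exact ⟨⟨a, ha, rfl⟩, by simp [rulingLine_skew_iff]⟩
      · refine ⟨⟨r * a / r', by rw [div_pow, mul_pow, hr, hr', ha]; simp, ?_⟩, by
          simp [rulingLine_skew_iff]⟩
        congr 1
        field_simp
  rw [h, Set.encard_pair]
  rw [Ne, rulingLine_inj, not_and_or]
  right
  exact fun h => hrr (mul_right_cancel₀ ha0 h).symm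

/-- The count `d + 2` splits as the whole opposite ruling on the same quadric plus two lines on the
other quadric. -/
theorem encard_meets (he : LinearIndependent k e)
    (hT : {a : k | a ^ (q + 1) = -1}.encard = (q + 1 : ℕ)) (hr : r ^ (q + 1) = 1)
    (hr' : r' ^ (q + 1) = 1) (hrr : r ≠ r') {l : ProjLine k} (hl : l ∈ ruling q e r) :
    {m ∈ ruling q (twist e) r ∪ ruling q e r' | ¬ l.Skew m}.encard = (q + 1 : ℕ) + 2 := by
  rw [← encard_meets_ruling he hr hr' hrr hl, ← encard_ruling he.twist hT r,
    ← Set.encard_union_eq]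
  · congr 1
    ext m
    simp only [Set.mem_ofPred_eq, Set.mem_union]
    have := fun hm => not_skew_of_mem_ruling he hl (m := m) (q := q) hm
    tauto
  · exact (disjoint_ruling_twist he r' r).symm.mono_right (Set.sep_subset _ _)

/-- One half of the double attached to a frame and two quadrics. -/
def doubleHalf (q : ℕ) (e : Fin 4 → Fin 4 → k) (r r' : k) : Set (ProjLine k) :=
  ruling q e r ∪ ruling q (twist e) r'

/-- This symmetry transfers statements about one ruling to the opposite one, and it is a source of
the multiplicity with which doubles are counted. -/
theorem doubleHalf_twist (e : Fin 4 → Fin 4 → k) (r r' : k) :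
    doubleHalf q (twist e) r r' = doubleHalf q e r' r := by
  rw [doubleHalf, doubleHalf, twist_twist, Set.union_comm]

theorem encard_doubleHalf (he : LinearIndependent k e)
    (hT : {a : k | a ^ (q + 1) = -1}.encard = (q + 1 : ℕ)) (r r' : k) :
    (doubleHalf q e r r').encard = 2 * (q + 1 : ℕ) := by
  rw [doubleHalf, Set.encard_union_eq (disjoint_ruling_twist he r r'), encard_ruling he hT,
    encard_ruling he.twist hT, two_mul]

theorem skew_of_mem_doubleHalf (he : LinearIndependent k e) (hr : r ^ (q + 1) = 1)
    (hr' : r' ^ (q + 1) = 1) (hrr : r ≠ r') {l m : ProjLine k} (hl : l ∈ doubleHalf q e r r')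
    (hm : m ∈ doubleHalf q e r r') (hlm : l ≠ m) : l.Skew m := by
  rcases hl with hl | hl <;> rcases hm with hm | hm
  · exact skew_of_mem_ruling he hr hl hm hlm
  · exact skew_of_mem_ruling_twist he hrr hl hm
  · exact (skew_of_mem_ruling_twist he hrr hm hl).symm
  · exact skew_of_mem_ruling he.twist hr' hl hm hlm

theorem encard_meets_doubleHalf (he : LinearIndependent k e)
    (hT : {a : k | a ^ (q + 1) = -1}.encard = (q + 1 : ℕ)) (hr : r ^ (q + 1) = 1)
    (hr' : r' ^ (q + 1) = 1) (hrr : r ≠ r') {l : ProjLine k} (hl : l ∈ doubleHalf q e r r') :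
    {m ∈ doubleHalf q e r' r | ¬ l.Skew m}.encard = (q + 1 : ℕ) + 2 := by
  rcases hl with hl | hl
  · rw [doubleHalf, Set.union_comm]
    exact encard_meets he hT hr hr' hrr hl
  · have := encard_meets he.twist hT hr' hr hrr.symm hl
    rwa [twist_twist] at this

theorem formDouble_doubleHalf (he : LinearIndependent k e)
    (hT : {a : k | a ^ (q + 1) = -1}.encard = (q + 1 : ℕ)) (hr : r ^ (q + 1) = 1)
    (hr' : r' ^ (q + 1) = 1) (hrr : r ≠ r') :
    FormDouble (q + 1) (doubleHalf q e r r') (doubleHalf q e r' r) where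
  card_left := encard_doubleHalf he hT r r'
  card_right := encard_doubleHalf he hT r' r
  skew_left _ hl _ hm := skew_of_mem_doubleHalf he hr hr' hrr hl hm
  skew_right _ hl _ hm := skew_of_mem_doubleHalf he hr' hr hrr.symm hl hm
  meets_left _ hl := encard_meets_doubleHalf he hT hr hr' hrr hl
  meets_right _ hl := encard_meets_doubleHalf he hT hr' hr hrr.symm hl

theorem IsOrthonormalFamily.twist {σ : k →+* k} {β : (Fin 4 → k) →ₛₗ[σ] (Fin 4 → k) →ₗ[k] k}
    (he : IsOrthonormalFamily β e) : IsOrthonormalFamily β (twist e) := by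
  rw [twist_eq_comp_swap]
  intro i j
  simp [he _ _]

theorem IsOrthonormalFamily.apply_linearCombination_self {σ : k →+* k} (hσ : ∀ x, σ x = x ^ q)
    {β : (Fin 4 → k) →ₛₗ[σ] (Fin 4 → k) →ₗ[k] k} (he : IsOrthonormalFamily β e)
    (c : Fin 4 → k) :
    β (Fintype.linearCombination k e c) (Fintype.linearCombination k e c) =
      ∑ i, c i ^ (q + 1) := by
  rw [Fintype.linearCombination_apply, map_sum β, LinearMap.sum_apply]
  refine Finset.sum_congr rfl fun i _ => ?_
  rw [β.map_smulₛₗ, LinearMap.smul_apply, he.apply_sum, hσ, smul_eq_mul, pow_succ]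

/-- On `x₀ = a x₂`, `x₃ = r a x₁` the terms of `∑ xᵢ ^ (q + 1)` cancel in the pairs `{0, 2}` and
`{1, 3}`. -/
theorem apply_self_of_mem_ruling {σ : k →+* k} (hσ : ∀ x, σ x = x ^ q)
    {β : (Fin 4 → k) →ₛₗ[σ] (Fin 4 → k) →ₗ[k] k} (he : IsOrthonormalFamily β e)
    (hr : r ^ (q + 1) = 1) {l : ProjLine k} (hl : l ∈ ruling q e r) {v : Fin 4 → k}
    (hv : v ∈ l.1) : β v v = 0 := by
  obtain ⟨a, ha, hla⟩ := hl
  rw [hla, mem_rulingPlane] at hv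
  obtain ⟨s, t, rfl⟩ := hv
  rw [he.apply_linearCombination_self hσ]
  simp [Fin.sum_univ_four, mul_pow, ha, hr]

theorem apply_self_of_mem_doubleHalf {σ : k →+* k} (hσ : ∀ x, σ x = x ^ q)
    {β : (Fin 4 → k) →ₛₗ[σ] (Fin 4 → k) →ₗ[k] k} (he : IsOrthonormalFamily β e)
    (hr : r ^ (q + 1) = 1) (hr' : r' ^ (q + 1) = 1) {l : ProjLine k}
    (hl : l ∈ doubleHalf q e r r') {v : Fin 4 → k} (hv : v ∈ l.1) : β v v = 0 :=
  hl.elim (fun hl => apply_self_of_mem_ruling hσ he hr hl hv)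
    fun hl => apply_self_of_mem_ruling hσ he.twist hr' hl hv

end Rulings

/-! ### Recovering the rulings from incidences -/

theorem Set.eq_of_union_eq_union_of_disjoint {α : Type*} {C S C₁ S₁ : Set α} (h : C ∪ S = C₁ ∪ S₁)
    (hd : Disjoint C S) (hd₁ : Disjoint C₁ S₁) (hC : C₁ = C) : S₁ = S := by
  subst hC
  rw [Set.disjoint_left] at hd hd₁
  ext x
  have h1 := Set.ext_iff.1 h x
  simp only [Set.mem_union] at h1
  have h2 := @hd x
  have h3 := @hd₁ x
  tauto

section Decomposition

variable {α : Type*} {R : α → α → Prop} {C S C' S' C₁ S₁ C₁' S₁' : Set α} {n : ℕ}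

/-- Equal cardinalities give `C₁ = C`. An element of `S₁` lying in `C'` would then be related to all
`n > 2` elements of `C`, so `S₁ = S`; the complements follow. -/
theorem decomposition_eq_of_subset (hn : 5 ≤ n) (hR : ∀ x y, R x y → R y x)
    (hA : C ∪ S' = C₁ ∪ S₁') (hdA : Disjoint C S') (hdA₁ : Disjoint C₁ S₁')
    (hB : S ∪ C' = S₁ ∪ C₁') (hdB : Disjoint S C') (hdB₁ : Disjoint S₁ C₁')
    (hC : C.encard = n) (hS : S.encard = n) (hC₁ : C₁.encard = n) (hS₁ : S₁.encard = n)
    (h3 : ∀ c ∈ C', {m ∈ C | R c m}.encard ≤ 2)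
    (hfull : ∀ c ∈ C₁, ∀ s ∈ S₁, R c s) (hsub : C₁ ⊆ C) :
    C₁ = C ∧ S₁ = S ∧ C₁' = C' ∧ S₁' = S' := by
  have h1 : C₁ = C := (Set.finite_of_encard_eq_coe hC₁).eq_of_subset_of_encard_le hsub
    (by rw [hC, hC₁])
  have h2 : S₁ = S := by
    refine (Set.finite_of_encard_eq_coe hS₁).eq_of_subset_of_encard_le (fun s hs => ?_)
      (by rw [hS, hS₁])
    rcases (hB ▸ Set.mem_union_left _ hs : s ∈ S ∪ C') with h | h
    · exact h
    · exfalso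
      have h4 : C₁.encard ≤ 2 := (Set.encard_le_encard
        (show C₁ ⊆ {m ∈ C | R s m} from fun c hc => ⟨hsub hc, hR _ _ (hfull c hc s hs)⟩)).trans (h3 s h)
      rw [hC₁] at h4
      have : n ≤ 2 := by exact_mod_cast h4
      omega
  exact ⟨h1, h2, Set.eq_of_union_eq_union_of_disjoint hB hdB hdB₁ h2,
    Set.eq_of_union_eq_union_of_disjoint hA hdA hdA₁ h1⟩

/-- In a double that is built from two grids, the grids can be recovered from the incidences. -/
theorem decomposition_eq_or (hn : 5 ≤ n) (hR : ∀ x y, R x y → R y x)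
    (hA : C ∪ S' = C₁ ∪ S₁') (hdA : Disjoint C S') (hdA₁ : Disjoint C₁ S₁')
    (hB : S ∪ C' = S₁ ∪ C₁') (hdB : Disjoint S C') (hdB₁ : Disjoint S₁ C₁')
    (hC : C.encard = n) (hS : S.encard = n) (hC' : C'.encard = n) (hS' : S'.encard = n)
    (hC₁ : C₁.encard = n) (hS₁ : S₁.encard = n)
    (h1 : ∀ c ∈ C, {m ∈ C' | R c m}.encard ≤ 2) (h2 : ∀ s ∈ S', {m ∈ S | R s m}.encard ≤ 2)
    (h3 : ∀ c ∈ C', {m ∈ C | R c m}.encard ≤ 2) (h4 : ∀ s ∈ S, {m ∈ S' | R s m}.encard ≤ 2)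
    (hfull : ∀ c ∈ C₁, ∀ s ∈ S₁, R c s) :
    (C₁ = C ∧ S₁ = S ∧ C₁' = C' ∧ S₁' = S') ∨ (C₁ = S' ∧ S₁ = C' ∧ C₁' = S ∧ S₁' = C) := by
  have hor : ∀ c ∈ C₁, c ∈ C ∨ c ∈ S' := fun c hc =>
    (hA ▸ Set.mem_union_left _ hc : c ∈ C ∪ S')
  by_cases hsub : C₁ ⊆ C
  · exact Or.inl (decomposition_eq_of_subset hn hR hA hdA hdA₁ hB hdB hdB₁ hC hS hC₁ hS₁ h3
      hfull hsub)
  by_cases hsub' : C₁ ⊆ S'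
  · exact Or.inr (decomposition_eq_of_subset hn hR (by rw [Set.union_comm, hA]) hdA.symm hdA₁
      (by rw [Set.union_comm, hB]) hdB.symm hdB₁ hS' hC' hC₁ hS₁ h4 hfull hsub')
  -- If `C₁` has `l ∈ S'` and `l' ∈ C`, every element of `S₁` is related to both. At most two of
  -- them lie in `S` (by `l`) and at most two in `C'` (by `l'`), so `n ≤ 4`.
  exfalso
  obtain ⟨l, hl, hlC⟩ := Set.not_subset.1 hsub
  obtain ⟨l', hl', hlS⟩ := Set.not_subset.1 hsub'
  have hlS' := (hor l hl).resolve_left hlC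
  have hlC' := (hor l' hl').resolve_right hlS
  have h5 : S₁ ⊆ {m ∈ S | R l m} ∪ {m ∈ C' | R l' m} := fun s hs =>
    (hB ▸ Set.mem_union_left _ hs : s ∈ S ∪ C').imp
      (fun h => ⟨h, hfull l hl s hs⟩) fun h => ⟨h, hfull l' hl' s hs⟩
  have h6 : S₁.encard ≤ 2 + 2 := (Set.encard_le_encard h5).trans
    ((Set.encard_union_le _ _).trans (add_le_add (h2 l hlS') (h1 l' hlC')))
  rw [hS₁] at h6
  have : n ≤ 2 + 2 := by exact_mod_cast h6
  omega

end Decomposition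

/-! ### Recovering the frame from the rulings -/

section Reconstruction

variable {k : Type*} [Field k] {q : ℕ} {e f : Fin 4 → Fin 4 → k} {a b r r' s s' : k}

/-- The two rulings of each of the two quadrics attached to a frame. -/
def rulingData (q : ℕ) (e : Fin 4 → Fin 4 → k) (r r' : k) :
    Set (ProjLine k) × Set (ProjLine k) × Set (ProjLine k) × Set (ProjLine k) :=
  (ruling q e r, ruling q (twist e) r, ruling q e r', ruling q (twist e) r')

theorem rulingData_eq_or (hq : 4 ≤ q) (he : LinearIndependent k e) (hf : LinearIndependent k f)
    (hT : {a : k | a ^ (q + 1) = -1}.encard = (q + 1 : ℕ))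
    (hr : r ^ (q + 1) = 1) (hr' : r' ^ (q + 1) = 1) (hrr : r ≠ r')
    (hA : doubleHalf q f s s' = doubleHalf q e r r')
    (hB : doubleHalf q f s' s = doubleHalf q e r' r) :
    rulingData q f s s' = rulingData q e r r' ∨
      rulingData q f s s' = rulingData q (twist e) r' r := by
  have h1 : ∀ {e : Fin 4 → Fin 4 → k} {r r' : k}, LinearIndependent k e → r ^ (q + 1) = 1 →
      r' ^ (q + 1) = 1 → r ≠ r' → ∀ l ∈ ruling q e r,
      {m ∈ ruling q e r' | ¬ l.Skew m}.encard ≤ 2 := fun he hr hr' hrr l hl =>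
    (encard_meets_ruling he hr hr' hrr hl).le
  have hc := fun {e : Fin 4 → Fin 4 → k} (he : LinearIndependent k e) (r : k) =>
    encard_ruling he hT r
  simp only [rulingData, Prod.mk.injEq, twist_twist]
  refine decomposition_eq_or (R := fun l m => ¬ l.Skew m) (by omega : 5 ≤ q + 1)
    (fun x y h h' => h h'.symm) hA.symm (disjoint_ruling_twist he _ _)
    (disjoint_ruling_twist hf _ _) ?_ (disjoint_ruling_twist he _ _).symm
    (disjoint_ruling_twist hf _ _).symm (hc he r) (hc he.twist r) (hc he r') (hc he.twist r')
    (hc hf s) (hc hf.twist s) (h1 he hr hr' hrr) (h1 he.twist hr' hr hrr.symm)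
    (h1 he hr' hr hrr.symm) (h1 he.twist hr hr' hrr)
    fun c hc s hs => not_skew_of_mem_ruling hf hc hs
  rw [Set.union_comm, Set.union_comm (ruling q (twist f) s)]
  exact hB.symm

/-- The planes spanned by the pairs of vectors of a frame that are the edges of a quadrangle. -/
def planeData (e : Fin 4 → Fin 4 → k) : (Submodule k (Fin 4 → k) × Submodule k (Fin 4 → k)) ×
    (Submodule k (Fin 4 → k) × Submodule k (Fin 4 → k)) :=
  ((Submodule.span k {e 0, e 2}, Submodule.span k {e 1, e 3}),
    (Submodule.span k {e 0, e 3}, Submodule.span k {e 1, e 2}))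

theorem finrank_span_pair_of_linearIndependent (he : LinearIndependent k e) {i j : Fin 4}
    (hij : i ≠ j) : Module.finrank k (Submodule.span k {e i, e j}) = 2 := by
  have hli : LinearIndependent k (e ∘ ![i, j]) := he.comp _ (by
    intro x y h
    fin_cases x <;> fin_cases y <;> simp_all)
  have := finrank_span_eq_card hli
  rwa [Set.range_comp, Matrix.range_cons, Matrix.range_cons, Matrix.range_empty, Set.union_empty,
    Set.singleton_union, Set.image_pair, Fintype.card_fin] at this

theorem span_pair_eq_of_mem {u v : Fin 4 → k} {P : Submodule k (Fin 4 → k)}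
    (hP : Module.finrank k P = 2) (huv : Module.finrank k (Submodule.span k {u, v}) = 2)
    (hab : a ≠ b) (ha : a • u + v ∈ P) (hb : b • u + v ∈ P) : Submodule.span k {u, v} = P := by
  have hu : u ∈ P := by
    have h1 := P.sub_mem ha hb
    rw [add_sub_add_right_eq_sub, ← sub_smul] at h1
    exact (P.smul_mem_iff (sub_ne_zero.2 hab)).1 h1
  have hv : v ∈ P := by simpa using P.sub_mem ha (P.smul_mem a hu)
  refine Submodule.eq_of_le_of_finrank_eq (Submodule.span_le.2 ?_) (huv.trans hP.symm)
  rintro x (rfl | rfl)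
  · exact hu
  · exact hv

/-- Pigeonhole: of three points `a • u + v`, two lie in the same one of `P`, `P'`, and two such
points determine the span. -/
theorem span_pair_eq_or {u v : Fin 4 → k} {P P' : Submodule k (Fin 4 → k)}
    (hP : Module.finrank k P = 2) (hP' : Module.finrank k P' = 2)
    (huv : Module.finrank k (Submodule.span k {u, v}) = 2) {T : Set k} (hT : 2 < T.encard)
    (h : ∀ a ∈ T, a • u + v ∈ P ∨ a • u + v ∈ P') :
    Submodule.span k {u, v} = P ∨ Submodule.span k {u, v} = P' := by
  obtain ⟨t, htT, ht⟩ := Set.exists_subset_encard_eq (k := 3) (Order.add_one_le_of_lt hT)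
  obtain ⟨a, b, c, hab, hac, hbc, rfl⟩ := Set.encard_eq_three.1 ht
  have ha := htT (by simp : a ∈ ({a, b, c} : Set k))
  have hb := htT (by simp : b ∈ ({a, b, c} : Set k))
  have hc := htT (by simp : c ∈ ({a, b, c} : Set k))
  rcases h a ha with h1 | h1 <;> rcases h b hb with h2 | h2 <;> rcases h c hc with h3 | h3
  · exact Or.inl (span_pair_eq_of_mem hP huv hab h1 h2)
  · exact Or.inl (span_pair_eq_of_mem hP huv hab h1 h2)
  · exact Or.inl (span_pair_eq_of_mem hP huv hac h1 h3)
  · exact Or.inr (span_pair_eq_of_mem hP' huv hbc h2 h3)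
  · exact Or.inl (span_pair_eq_of_mem hP huv hbc h2 h3)
  · exact Or.inr (span_pair_eq_of_mem hP' huv hac h1 h3)
  · exact Or.inr (span_pair_eq_of_mem hP' huv hab h1 h2)
  · exact Or.inr (span_pair_eq_of_mem hP' huv hab h1 h2)

/-- Corresponding rulings of the two quadrics meet only on two opposite edges of the coordinate
tetrahedron, so these edges can be read off from the rulings. -/
theorem mem_span_pair_of_mem_rulingPlane (hf : LinearIndependent k f) (hs : s ≠ s') (ha : a ≠ 0)
    {x : Fin 4 → k} (hx : x ∈ rulingPlane f a (s * a)) (hx' : x ∈ rulingPlane f b (s' * b)) :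
    x ∈ Submodule.span k {f 0, f 2} ∨ x ∈ Submodule.span k {f 1, f 3} := by
  obtain ⟨y, z, rfl⟩ := mem_rulingPlane.1 hx
  obtain ⟨y', z', h⟩ := mem_rulingPlane.1 hx'
  have h1 := linearCombination_injective hf h
  have e0 : y * a = y' * b := congrFun h1 0
  have e1 : z = z' := congrFun h1 1
  have e2 : y = y' := congrFun h1 2
  have e3 : z * (s * a) = z' * (s' * b) := congrFun h1 3
  subst e1 e2
  simp only [Submodule.mem_span_pair, Fintype.linearCombination_apply, Fin.sum_univ_four]
  by_cases hy : y = 0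
  · subst hy
    exact Or.inr ⟨z, z * (s * a), by simp⟩
  · obtain rfl := mul_left_cancel₀ hy e0
    have hz : z = 0 := by
      by_contra hz
      exact hs (mul_right_cancel₀ ha (mul_left_cancel₀ hz e3))
    subst hz
    exact Or.inl ⟨y * a, y, by simp⟩

/-- Each of the edges `⟨e 0, e 2⟩`, `⟨e 1, e 3⟩` contains more than two intersection points of the
rulings. All such points lie on the corresponding edges of `f`, so the two pairs of edges agree up
to order. -/
theorem span_pairs_eq_or (he : LinearIndependent k e) (hf : LinearIndependent k f)
    (hT : 2 < {a : k | a ^ (q + 1) = -1}.encard)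
    (hr : r ^ (q + 1) = 1) (hr' : r' ^ (q + 1) = 1) (hss : s ≠ s')
    (h : ruling q f s = ruling q e r) (h' : ruling q f s' = ruling q e r') :
    (planeData f).1 = (planeData e).1 ∨ (planeData f).1 = (planeData e).1.swap := by
  have hpt : ∀ {a a' : k} {x : Fin 4 → k}, a ^ (q + 1) = -1 → a' ^ (q + 1) = -1 →
      x ∈ rulingPlane e a (r * a) → x ∈ rulingPlane e a' (r' * a') →
      x ∈ Submodule.span k {f 0, f 2} ∨ x ∈ Submodule.span k {f 1, f 3} := by
    intro a a' x ha ha' hx hx'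
    obtain ⟨b, hb, hl⟩ : rulingLine he a (r * a) ∈ ruling q f s := h ▸ ⟨a, ha, rfl⟩
    obtain ⟨b', hb', hl'⟩ : rulingLine he a' (r' * a') ∈ ruling q f s' := h' ▸ ⟨a', ha', rfl⟩
    have h1 : rulingPlane e a (r * a) = rulingPlane f b (s * b) := hl
    have h2 : rulingPlane e a' (r' * a') = rulingPlane f b' (s' * b') := hl'
    rw [h1] at hx
    rw [h2] at hx'
    exact mem_span_pair_of_mem_rulingPlane hf hss (ne_zero_of_pow_succ_eq_neg_one hb) hx hx'
  have hr0 := ne_zero_of_pow_succ_eq_one hr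
  have hr0' := ne_zero_of_pow_succ_eq_one hr'
  have hfr : ∀ {e : Fin 4 → Fin 4 → k}, LinearIndependent k e → ∀ {i j}, i ≠ j →
    Module.finrank k (Submodule.span k {e i, e j}) = 2 :=
    fun he _ _ => finrank_span_pair_of_linearIndependent he
  have h1 := span_pair_eq_or (hfr hf (i := 0) (j := 2) (by decide))
    (hfr hf (i := 1) (j := 3) (by decide)) (hfr he (i := 0) (j := 2) (by decide)) hT
    fun a ha => hpt ha ha (Submodule.subset_span (Set.mem_insert _ _))
      (Submodule.subset_span (Set.mem_insert _ _))
  -- The point `c • e 3 + e 1` lies on the line of the first quadric with parameter `a` when `r a =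
  -- c`, hence the parameters `c / r` and `c / r'`.
  have h2 := span_pair_eq_or (hfr hf (i := 0) (j := 2) (by decide))
    (hfr hf (i := 1) (j := 3) (by decide)) (hfr he (i := 3) (j := 1) (by decide)) hT
    fun c hc => hpt (a := c / r) (a' := c / r') (by rw [div_pow, hr, hc, div_one])
      (by rw [div_pow, hr', hc, div_one])
      (mem_rulingPlane.2 ⟨0, 1, by
        simp [Fintype.linearCombination_apply, Fin.sum_univ_four, mul_div_cancel₀ c hr0, add_comm]⟩)
      (mem_rulingPlane.2 ⟨0, 1, by
        simp [Fintype.linearCombination_apply, Fin.sum_univ_four, mul_div_cancel₀ c hr0',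
          add_comm]⟩)
  rw [Set.pair_comm (e 3)] at h2
  have hne : Submodule.span k {e 0, e 2} ≠ Submodule.span k {e 1, e 3} := by
    intro h3
    have h4 : e 0 ∈ Submodule.span k {e 1, e 3} := h3 ▸ Submodule.subset_span (by simp)
    obtain ⟨x, y, hxy⟩ := Submodule.mem_span_pair.1 h4
    have h5 := linearCombination_injective he (a₁ := ![1, 0, 0, 0]) (a₂ := ![0, x, 0, y])
      (by simp [Fintype.linearCombination_apply, Fin.sum_univ_four, hxy])
    exact one_ne_zero (congrFun h5 0)
  simp only [planeData, Prod.swap_prod_mk, Prod.mk.injEq]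
  rcases h1 with h1 | h1 <;> rcases h2 with h2 | h2
  · exact absurd (h1.trans h2.symm) hne
  · exact Or.inl ⟨h1.symm, h2.symm⟩
  · exact Or.inr ⟨h2.symm, h1.symm⟩
  · exact absurd (h1.trans h2.symm) hne

theorem planeData_twist (e : Fin 4 → Fin 4 → k) : planeData (twist e) = (planeData e).swap := rfl

/-- The given rulings fix one pair of opposite edges up to order, and the twisted rulings fix the
other pair: `2 * 2` possibilities. -/
theorem planeData_mem_of_rulingData_eq (he : LinearIndependent k e) (hf : LinearIndependent k f)
    (hT : 2 < {a : k | a ^ (q + 1) = -1}.encard)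
    (hr : r ^ (q + 1) = 1) (hr' : r' ^ (q + 1) = 1) (hss : s ≠ s')
    (h : rulingData q f s s' = rulingData q e r r') :
    planeData f = planeData e ∨ planeData f = ((planeData e).1.swap, (planeData e).2) ∨
      planeData f = ((planeData e).1, (planeData e).2.swap) ∨
      planeData f = ((planeData e).1.swap, (planeData e).2.swap) := by
  simp only [rulingData, Prod.mk.injEq] at h
  obtain ⟨h1, h2, h3, h4⟩ := h
  have h5 := span_pairs_eq_or he hf hT hr hr' hss h1 h3
  have h6 := span_pairs_eq_or he.twist hf.twist hT hr hr' hss h2 h4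
  rw [planeData_twist, planeData_twist, Prod.fst_swap, Prod.fst_swap] at h6
  rcases h5 with h5 | h5 <;> rcases h6 with h6 | h6
  · exact Or.inl (Prod.ext h5 h6)
  · exact Or.inr (Or.inr (Or.inl (Prod.ext h5 h6)))
  · exact Or.inr (Or.inl (Prod.ext h5 h6))
  · exact Or.inr (Or.inr (Or.inr (Prod.ext h5 h6)))

variable {σ : k →+* k} {β : (Fin 4 → k) →ₛₗ[σ] (Fin 4 → k) →ₗ[k] k}

theorem IsOrthonormalFamily.eq_smul_of_mem_span_pair (he : IsOrthonormalFamily β e)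
    {i j l : Fin 4} (hij : j ≠ i) (hjl : j ≠ l) {v : Fin 4 → k}
    (hv : v ∈ Submodule.span k {e i, e j}) (hv' : v ∈ Submodule.span k {e i, e l}) :
    v = β (e i) v • e i := by
  obtain ⟨x, y, rfl⟩ := Submodule.mem_span_pair.1 hv
  obtain ⟨x', y', h⟩ := Submodule.mem_span_pair.1 hv'
  have h1 := congrArg (β (e j)) h
  simp only [map_add, map_smul, he _ _, hij, hjl, if_true, if_false, smul_eq_mul, mul_zero,
    mul_one, add_zero, zero_add] at h1
  subst h1
  simp [he _ _]

/-- Each frame vector lies on two of the four edges, and these two meet only in its span. -/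
theorem IsOrthonormalFamily.eq_smul_of_planeData_eq (he : IsOrthonormalFamily β e)
    (h : planeData f = planeData e) (i : Fin 4) : f i = β (e i) (f i) • e i := by
  simp only [planeData, Prod.mk.injEq] at h
  obtain ⟨⟨h1, h2⟩, h3, h4⟩ := h
  have hm : ∀ {x y : Fin 4 → k}, x ∈ Submodule.span k {x, y} ∧ y ∈ Submodule.span k {x, y} :=
    fun {x y} => ⟨Submodule.subset_span (by simp), Submodule.subset_span (by simp)⟩
  fin_cases i
  · exact he.eq_smul_of_mem_span_pair (j := 2) (l := 3) (by decide) (by decide)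
      (h1 ▸ hm.1) (h3 ▸ hm.1)
  · exact he.eq_smul_of_mem_span_pair (j := 3) (l := 2) (by decide) (by decide)
      (h2 ▸ hm.1) (h4 ▸ hm.1)
  · exact he.eq_smul_of_mem_span_pair (j := 0) (l := 1) (by decide) (by decide)
      (Set.pair_comm (e 0) (e 2) ▸ h1 ▸ hm.2) (Set.pair_comm (e 1) (e 2) ▸ h4 ▸ hm.2)
  · exact he.eq_smul_of_mem_span_pair (j := 1) (l := 0) (by decide) (by decide)
      (Set.pair_comm (e 1) (e 3) ▸ h2 ▸ hm.2) (Set.pair_comm (e 0) (e 3) ▸ h3 ▸ hm.2)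

theorem ruling_injective (he : LinearIndependent k e) (ha : a ^ (q + 1) = -1)
    (h : ruling q e r = ruling q e s) : r = s := by
  have h1 : rulingLine he a (r * a) ∈ ruling q e s := h ▸ ⟨a, ha, rfl⟩
  obtain ⟨b, -, hb⟩ := (mem_ruling he).1 h1
  obtain ⟨rfl, h2⟩ := (rulingLine_inj he).1 hb
  exact mul_right_cancel₀ (ne_zero_of_pow_succ_eq_neg_one ha) h2

end Reconstruction

/-! ### Multiplicity of the construction -/

section Count

variable {k : Type*} [Field k] {q : ℕ} {σ : k →+* k}
  {β : (Fin 4 → k) →ₛₗ[σ] (Fin 4 → k) →ₗ[k] k}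

/-- The unordered pair of halves of the double attached to a frame and two quadrics. -/
def framedDouble (q : ℕ) (x : (Fin 4 → Fin 4 → k) × k × k) : Sym2 (Set (ProjLine k)) :=
  s(doubleHalf q x.1 x.2.1 x.2.2, doubleHalf q x.1 x.2.2 x.2.1)

/-- The rulings and the quadrangle attached to a frame and two quadrics. -/
def framedData (q : ℕ) (x : (Fin 4 → Fin 4 → k) × k × k) :=
  (rulingData q x.1 x.2.1 x.2.2, planeData x.1)

/-- Frames with the same edges differ by scalars, which are `(q + 1)`-th roots of unity because both
frames are normalized. The rulings then determine `r` and `r'`, so a fibre embeds in `μ ^ 4`. -/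
theorem card_le_card_image_framedData [DecidableEq (Set (ProjLine k))]
    [DecidableEq (Submodule k (Fin 4 → k))] [DecidableEq k] (hσ : ∀ x, σ x = x ^ q)
    {a : k} (ha : a ^ (q + 1) = -1) {μ : Finset k} (hμ : ∀ x, x ∈ μ ↔ x ^ (q + 1) = 1)
    {P : Finset ((Fin 4 → Fin 4 → k) × k × k)} (hP : ∀ x ∈ P, IsOrthonormalFamily β x.1) :
    P.card ≤ μ.card ^ 4 * (P.image (framedData q)).card := by
  refine Finset.card_le_mul_card_image P _ fun d hd => ?_
  obtain ⟨⟨e, r, r'⟩, hx, rfl⟩ := Finset.mem_image.1 hd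
  have he : IsOrthonormalFamily β e := hP _ hx
  have hsmul : ∀ {f s s'}, framedData q (f, s, s') = framedData q (e, r, r') →
      ∀ i, f i = β (e i) (f i) • e i := fun h =>
    he.eq_smul_of_planeData_eq (congrArg Prod.snd h)
  have hcard : (Fintype.piFinset fun _ : Fin 4 => μ).card = μ.card ^ 4 := by simp
  rw [← hcard]
  refine Finset.card_le_card_of_injOn (fun x i => β (e i) (x.1 i)) ?_ ?_
  · rintro ⟨f, s, s'⟩ hf
    obtain ⟨hfP, hfd⟩ := Finset.mem_filter.1 hf
    refine Fintype.mem_piFinset.2 fun i => (hμ _).2 ?_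
    have h1 : β (f i) (f i) = 1 := by rw [hP _ hfP, if_pos rfl]
    rw [hsmul hfd i, β.map_smulₛₗ, LinearMap.smul_apply, (β _).map_smul, he, if_pos rfl, hσ,
      smul_eq_mul, smul_eq_mul, mul_one, ← pow_succ] at h1
    exact h1
  · rintro ⟨f, s, s'⟩ hf ⟨g, t, t'⟩ hg hfg
    obtain ⟨hfP, hfd⟩ := Finset.mem_filter.1 hf
    obtain ⟨-, hgd⟩ := Finset.mem_filter.1 hg
    obtain rfl : f = g := funext fun i => by
      rw [hsmul hfd i, hsmul hgd i]
      exact congrArg (· • e i) (congrFun hfg i)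
    have hfi := (hP _ hfP).linearIndependent
    have h2 := congrArg Prod.fst (hfd.trans hgd.symm)
    simp only [framedData, rulingData, Prod.mk.injEq] at h2
    rw [ruling_injective hfi ha h2.1, ruling_injective hfi ha h2.2.2.1]

theorem card_image_framedData_le [DecidableEq (Set (ProjLine k))]
    [DecidableEq (Submodule k (Fin 4 → k))]
    (hT : 2 < {a : k | a ^ (q + 1) = -1}.encard)
    {P : Finset ((Fin 4 → Fin 4 → k) × k × k)}
    (hP : ∀ x ∈ P, LinearIndependent k x.1 ∧ x.2.1 ^ (q + 1) = 1 ∧ x.2.2 ^ (q + 1) = 1 ∧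
      x.2.1 ≠ x.2.2) :
    (P.image (framedData q)).card ≤ 4 * ((P.image (framedData q)).image Prod.fst).card := by
  refine Finset.card_le_mul_card_image _ _ fun d hd => ?_
  rw [Finset.image_image] at hd
  obtain ⟨⟨e, r, r'⟩, hx, rfl⟩ := Finset.mem_image.1 hd
  obtain ⟨he, hr, hr', hrr⟩ := hP _ hx
  set D := rulingData q e r r'
  refine (Finset.card_le_card (t := {(D, planeData e),
    (D, ((planeData e).1.swap, (planeData e).2)), (D, ((planeData e).1, (planeData e).2.swap)),
    (D, ((planeData e).1.swap, (planeData e).2.swap))}) fun y hy => ?_).trans Finset.card_le_four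
  obtain ⟨hy, hyd⟩ := Finset.mem_filter.1 hy
  obtain ⟨⟨f, s, s'⟩, hf, rfl⟩ := Finset.mem_image.1 hy
  have hyd' : rulingData q f s s' = D := hyd
  have := planeData_mem_of_rulingData_eq he (hP _ hf).1 hT hr hr' (hP _ hf).2.2.2 hyd'
  simp only [framedData, hyd', Finset.mem_insert, Finset.mem_singleton, Prod.mk.injEq D,
    true_and]
  exact this

/-- The factor 4 is two orders of the halves times the two decompositions in `rulingData_eq_or`. -/
theorem card_image_rulingData_le [DecidableEq (Set (ProjLine k))]
    [DecidableEq (Sym2 (Set (ProjLine k)))] (hq : 4 ≤ q)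
    (hT : {a : k | a ^ (q + 1) = -1}.encard = (q + 1 : ℕ))
    {P : Finset ((Fin 4 → Fin 4 → k) × k × k)}
    (hP : ∀ x ∈ P, LinearIndependent k x.1 ∧ x.2.1 ^ (q + 1) = 1 ∧ x.2.2 ^ (q + 1) = 1 ∧
      x.2.1 ≠ x.2.2) :
    (P.image fun x => rulingData q x.1 x.2.1 x.2.2).card ≤
      4 * (P.image (framedDouble q)).card := by
  have himg : P.image (framedDouble q) = (P.image fun x => rulingData q x.1 x.2.1 x.2.2).image
      fun y => s(y.1 ∪ y.2.2.2, y.2.2.1 ∪ y.2.1) := by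
    rw [Finset.image_image]
    rfl
  rw [himg]
  refine Finset.card_le_mul_card_image _ _ fun d hd => ?_
  rw [Finset.image_image] at hd
  obtain ⟨⟨e, r, r'⟩, hx, rfl⟩ := Finset.mem_image.1 hd
  obtain ⟨he, hr, hr', hrr⟩ := hP _ hx
  refine (Finset.card_le_card (t := {rulingData q e r r', rulingData q (twist e) r' r,
    rulingData q (twist e) r r', rulingData q e r' r}) fun y hy => ?_).trans Finset.card_le_four
  obtain ⟨hy, hyd⟩ := Finset.mem_filter.1 hy
  obtain ⟨⟨f, s, s'⟩, hf, rfl⟩ := Finset.mem_image.1 hy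
  have hfi := (hP _ hf).1
  have hyd' : s(doubleHalf q f s s', doubleHalf q f s' s) =
    s(doubleHalf q e r r', doubleHalf q e r' r) := hyd
  simp only [Finset.mem_insert, Finset.mem_singleton]
  rcases Sym2.eq_iff.1 hyd' with ⟨h1, h2⟩ | ⟨h1, h2⟩
  · rcases rulingData_eq_or hq he hfi hT hr hr' hrr h1 h2 with h | h
    · exact Or.inl h
    · exact Or.inr (Or.inl h)
  -- Exchanged halves are the halves of the twisted frame in the original order.
  · have h3 := rulingData_eq_or hq he.twist hfi hT hr hr' hrr
      (h1.trans (doubleHalf_twist e r r').symm) (h2.trans (doubleHalf_twist e r' r).symm)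
    rw [twist_twist] at h3
    exact Or.inr (Or.inr h3)

end Count

/-- The factor `(q + 1) * q` counts ordered pairs `r ≠ r'`, and `(q + 1) ^ 4` is the rescaling
ambiguity to be cancelled. -/
theorem prod_card_hermitianUnitVectors {k : Type*} [Field k] [IsAlgClosed k] {q : ℕ}
    (hq : 2 ≤ q) (σ : k →+* k) (hσ : ∀ x, σ x = x ^ q) (hq0 : (q : k) = 0)
    {E : Finset k} (hE : E.card = q ^ 2) (hEm : ∀ x, x ∈ E ↔ x ^ q ^ 2 = x) :
    (∏ i ∈ Finset.range 4, (hermitianUnitVectors E q (i + 1)).card) * ((q + 1) * q) =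
      (q + 1) ^ 4 * ((q ^ 3 + 1) * (q ^ 2 + 1) * (q - 1) ^ 2 * q ^ 7) := by
  have hrec := card_hermitianUnitVectors_succ hq σ hσ hq0 hE hEm
  have h0 : (hermitianUnitVectors E q 0).card = 0 := by
    rw [Finset.card_eq_zero, Finset.eq_empty_iff_forall_notMem]
    intro x hx
    exact zero_ne_one (mem_hermitianUnitVectors.1 hx).2
  obtain ⟨m, rfl⟩ : ∃ m, q = m + 1 := ⟨q - 1, by omega⟩
  have h1 : (hermitianUnitVectors E (m + 1) 1).card = m + 2 := by
    have := hrec 0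
    rw [h0] at this
    simpa using this
  have h2 : (hermitianUnitVectors E (m + 1) 2).card = (m + 2) * (m + 1) * m := by
    have := hrec 1
    rw [h1] at this
    exact Nat.add_right_cancel (this.trans (by ring))
  have h3 : (hermitianUnitVectors E (m + 1) 3).card = (m + 1) ^ 2 * ((m + 1) ^ 3 + 1) := by
    have := hrec 2
    rw [h2] at this
    exact Nat.add_right_cancel (this.trans (by ring))
  have h4 : (hermitianUnitVectors E (m + 1) 4).card =
      (m + 1) ^ 3 * (m * (m + 2) * ((m + 1) ^ 2 + 1)) := by
    have := hrec 3
    rw [h3] at this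
    exact Nat.add_right_cancel (this.trans (by ring))
  simp only [Finset.prod_range_succ, Finset.prod_range_zero, Nat.reduceAdd, h1, h2, h3,
    h4, Nat.add_sub_cancel]
  ring

/-! ### From smooth Frobenius forms to nondegenerate sesquilinear forms -/

section FrobeniusForm

variable {k : Type*} [Field k] {q : ℕ} {σ : k →+* k}

theorem IsFrobeniusForm.exists_matrix {F : MvPolynomial (Fin 4) k} (hF : IsFrobeniusForm q F) :
    ∃ A : Matrix (Fin 4) (Fin 4) k, F = ∑ i, MvPolynomial.X i ^ q *
      ∑ j, MvPolynomial.C (A i j) * MvPolynomial.X j := by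
  obtain ⟨L, hL, rfl⟩ := hF
  have h : ∀ i, ∃ c : Fin 4 → k, ∑ j, c j • (MvPolynomial.X j : MvPolynomial (Fin 4) k) = L i := by
    intro i
    have h1 : L i ∈ MvPolynomial.homogeneousSubmodule (Fin 4) k 1 := hL i
    rw [MvPolynomial.homogeneousSubmodule_one_eq_span_X] at h1
    exact (Submodule.mem_span_range_iff_exists_fun k).1 h1
  choose A hA using h
  refine ⟨A, Finset.sum_congr rfl fun i _ => ?_⟩
  simp only [← hA i, MvPolynomial.smul_eq_C_mul]

/-- The sesquilinear form with a given matrix. -/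
def frobeniusSesq (q : ℕ) (hσ : ∀ x, σ x = x ^ q) (A : Matrix (Fin 4) (Fin 4) k) :
    (Fin 4 → k) →ₛₗ[σ] (Fin 4 → k) →ₗ[k] k :=
  LinearMap.mk₂'ₛₗ σ (RingHom.id k) (fun x y => ∑ i, x i ^ q * ∑ j, A i j * y j)
    (fun x x' y => by
      simp only [← hσ, Pi.add_apply, map_add, add_mul, Finset.sum_add_distrib])
    (fun c x y => by
      simp only [← hσ, Pi.smul_apply, smul_eq_mul, map_mul, mul_assoc, Finset.mul_sum])
    (fun x y y' => by
      simp only [Pi.add_apply, mul_add, Finset.sum_add_distrib])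
    (fun c x y => by
      simp only [Pi.smul_apply, smul_eq_mul, RingHom.id_apply, Finset.mul_sum]
      exact Finset.sum_congr rfl fun i _ => Finset.sum_congr rfl fun j _ => by ring)

theorem frobeniusSesq_apply (hσ : ∀ x, σ x = x ^ q) (A : Matrix (Fin 4) (Fin 4) k)
    (x y : Fin 4 → k) : frobeniusSesq q hσ A x y = ∑ i, x i ^ q * ∑ j, A i j * y j := rfl

/-- As `q = 0` in `k`, only the linear factors get differentiated, so the `l`-th partial derivative
at `v` is `β` of `v` and the `l`-th basis vector. A nonzero vector of the left kernel would be a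
singular point. -/
theorem frobeniusSesq_left_nondegenerate (hq0 : (q : k) = 0) (hσ : ∀ x, σ x = x ^ q)
    (A : Matrix (Fin 4) (Fin 4) k) (hF : IsSmoothSurface (∑ i, MvPolynomial.X i ^ q *
      ∑ j, MvPolynomial.C (A i j) * MvPolynomial.X j)) (v : Fin 4 → k)
    (hv : ∀ y, frobeniusSesq q hσ A v y = 0) : v = 0 := by
  by_contra hv0
  obtain ⟨l, hl⟩ := hF v hv0 (by simpa [frobeniusSesq_apply] using hv v)
  refine hl ?_
  have h1 := hv (Pi.single l 1)
  simp only [frobeniusSesq_apply, Pi.single_apply, mul_ite, mul_one, mul_zero,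
    Finset.sum_ite_eq', Finset.mem_univ, if_true] at h1
  rw [← h1, map_sum, map_sum]
  refine Finset.sum_congr rfl fun i _ => ?_
  have hq0' : (q : MvPolynomial (Fin 4) k) = 0 := by
    rw [← map_natCast (MvPolynomial.C (σ := Fin 4)), hq0, map_zero]
  rw [Derivation.leibniz, Derivation.leibniz_pow]
  simp [hq0', MvPolynomial.pderiv_X, Pi.single_apply]

/-- A right kernel makes the matrix singular, hence gives a nonzero `w` with `w A = 0`;
coordinatewise `q`-th roots of `w` form a vector of the left kernel. -/
theorem frobeniusSesq_right_nondegenerate [IsAlgClosed k] (hq : 2 ≤ q) (hσ : ∀ x, σ x = x ^ q)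
    (A : Matrix (Fin 4) (Fin 4) k) (hl : ∀ v, (∀ y, frobeniusSesq q hσ A v y = 0) → v = 0)
    (v : Fin 4 → k) (hv : ∀ y, frobeniusSesq q hσ A y v = 0) : v = 0 := by
  by_contra hv0
  have hAv : A.mulVec v = 0 := by
    funext i
    have h1 := hv (Pi.single i 1)
    rw [frobeniusSesq_apply, Finset.sum_eq_single i] at h1
    · simpa [Matrix.mulVec, dotProduct] using h1
    · intro j _ hj
      simp [hj, show q ≠ 0 by omega]
    · simp
  obtain ⟨w, hw0, hw⟩ := Matrix.exists_vecMul_eq_zero_iff.2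
    (Matrix.exists_mulVec_eq_zero_iff.1 ⟨v, hv0, hAv⟩)
  choose u hu using fun i => IsAlgClosed.exists_pow_nat_eq (w i) (show 0 < q by omega)
  refine hw0 (funext fun i => ?_)
  have hu0 : u = 0 := hl u fun y => by
    simp only [frobeniusSesq_apply, hu]
    have h2 : dotProduct (Matrix.vecMul w A) y = 0 := by rw [hw, zero_dotProduct]
    rw [← Matrix.dotProduct_mulVec] at h2
    exact h2
  rw [← hu, hu0]
  simp [show q ≠ 0 by omega]

end FrobeniusForm

/-! ### The lower bound and its asymptotics -/

theorem le_encard_doublesOn {k : Type*} [Field k] [IsAlgClosed k] {q : ℕ} (hq : 4 ≤ q)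
    (σ : k →+* k) (hσ : ∀ x, σ x = x ^ q) (hq0 : (q : k) = 0) {F : MvPolynomial (Fin 4) k}
    (hF : IsSmoothExtremalSurface q F) :
    (((q ^ 3 + 1) * (q ^ 2 + 1) * (q - 1) ^ 2 * q ^ 7 : ℕ) : ℕ∞) ≤
      16 * (doublesOn (q + 1) F).encard := by
  classical
  obtain ⟨A, rfl⟩ := hF.1.exists_matrix
  have hl := frobeniusSesq_left_nondegenerate hq0 hσ A hF.2
  set β := frobeniusSesq q hσ A
  obtain ⟨E, hE, hEm⟩ := exists_finset_pow_sq_eq_self (k := k) (by omega) hq0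
  obtain ⟨μ, hμ, hμm⟩ := exists_finset_pow_succ_eq hq0 (one_ne_zero (α := k))
  obtain ⟨T, hTc, hTm⟩ := exists_finset_pow_succ_eq hq0 (neg_ne_zero.2 (one_ne_zero (α := k)))
  have hT : {a : k | a ^ (q + 1) = -1}.encard = (q + 1 : ℕ) := by
    have hTs : {a : k | a ^ (q + 1) = -1} = T := Set.ext fun a => (hTm a).symm
    rw [hTs, Set.encard_coe_eq_coe_finsetCard, hTc]
  have hT2 : 2 < {a : k | a ^ (q + 1) = -1}.encard := by
    rw [hT]
    exact_mod_cast (by omega : 2 < q + 1)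
  obtain ⟨a, ha⟩ : T.Nonempty := Finset.card_pos.1 (by omega)
  rw [hTm] at ha
  obtain ⟨S, hS, hSc⟩ := exists_finset_isOrthonormalFamily (by omega) hσ hq0 hE hEm 4
    (Fin 4 → k) β hl (frobeniusSesq_right_nondegenerate (by omega) hσ A hl) (by simp)
  set P := S ×ˢ μ.offDiag with hP
  have hPm : ∀ x ∈ P, IsOrthonormalFamily β x.1 ∧ x.2.1 ^ (q + 1) = 1 ∧
      x.2.2 ^ (q + 1) = 1 ∧ x.2.1 ≠ x.2.2 := by
    intro x hx
    rw [hP, Finset.mem_product, Finset.mem_offDiag, hμm, hμm] at hx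
    exact ⟨hS _ hx.1, hx.2⟩
  have hPi : ∀ x ∈ P, LinearIndependent k x.1 ∧ x.2.1 ^ (q + 1) = 1 ∧
      x.2.2 ^ (q + 1) = 1 ∧ x.2.1 ≠ x.2.2 := fun x hx =>
    ⟨(hPm x hx).1.linearIndependent, (hPm x hx).2⟩
  have h1 := card_le_card_image_framedData hσ ha hμm fun x hx => (hPm x hx).1
  have h2 := card_image_framedData_le hT2 hPi
  have h3 := card_image_rulingData_le hq hT hPi
  rw [Finset.image_image] at h2
  have h4 : (P.image (Prod.fst ∘ framedData q)).card ≤ 4 * (P.image (framedDouble q)).card := h3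
  have h5 : P.card = S.card * ((q + 1) * q) := by
    rw [hP, Finset.card_product, Finset.offDiag_card, hμ]
    congr 1
    rw [Nat.mul_succ, Nat.add_sub_cancel]
  have h6 := prod_card_hermitianUnitVectors (by omega) σ hσ hq0 hE hEm
  -- The left side is at most the number of triples in `P`, which by `h1`, `h2`, `h3` is at most `(q
  -- + 1) ^ 4 * 4 * 4` times the number of doubles obtained.
  have h7 : (q + 1) ^ 4 * ((q ^ 3 + 1) * (q ^ 2 + 1) * (q - 1) ^ 2 * q ^ 7) ≤
      (q + 1) ^ 4 * (16 * (P.image (framedDouble q)).card) := by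
    rw [← h6]
    refine (Nat.mul_le_mul_right _ hSc).trans ?_
    rw [← h5]
    refine h1.trans ?_
    rw [hμ]
    exact Nat.mul_le_mul_left _ (by omega)
  have h8 := Nat.le_of_mul_le_mul_left h7 (by positivity)
  have h9 : ((P.image (framedDouble q) : Finset _) : Set (Sym2 (Set (ProjLine k)))) ⊆
      doublesOn (q + 1) (∑ i, MvPolynomial.X i ^ q *
        ∑ j, MvPolynomial.C (A i j) * MvPolynomial.X j) := by
    intro D hD
    obtain ⟨⟨e, r, r'⟩, hx, rfl⟩ := Finset.mem_image.1 (Finset.mem_coe.1 hD)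
    obtain ⟨he, hr, hr', hrr⟩ := hPm _ hx
    have heval : ∀ v, MvPolynomial.eval v (∑ i, MvPolynomial.X i ^ q *
        ∑ j, MvPolynomial.C (A i j) * MvPolynomial.X j) = β v v := fun v => by
      simp [β, frobeniusSesq_apply]
    exact ⟨_, _, rfl, formDouble_doubleHalf he.linearIndependent hT hr hr' hrr,
      fun l hl v hv => (heval v).trans (apply_self_of_mem_doubleHalf hσ he hr hr' hl hv),
      fun l hl v hv => (heval v).trans (apply_self_of_mem_doubleHalf hσ he hr' hr hl hv)⟩
  have h10 := Set.encard_le_encard h9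
  rw [Set.encard_coe_eq_coe_finsetCard] at h10
  refine (Nat.cast_le.2 h8).trans ?_
  rw [Nat.cast_mul]
  exact mul_le_mul_right h10 _

theorem doubleCount_isEquivalent :
    (fun d : ℕ => (1 / 16 : ℝ) * (((d : ℝ) - 1) ^ 3 + 1) * (((d : ℝ) - 1) ^ 2 + 1)
        * (((d : ℝ) - 1) - 1) ^ 2 * ((d : ℝ) - 1) ^ 7)
      ~[atTop] (fun d : ℕ => (1 / 16 : ℝ) * (d : ℝ) ^ 14) := by
  have htop : Tendsto (fun d : ℕ => (d : ℝ)) atTop atTop := tendsto_natCast_atTop_atTop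
  have hadd : ∀ {u v : ℕ → ℝ}, u ~[atTop] v → Tendsto v atTop atTop → ∀ c : ℝ,
      (fun d => u d + c) ~[atTop] v := fun {u v} huv hv c =>
    huv.add_isLittleO (isLittleO_const_left.2 (Or.inr (tendsto_norm_atTop_atTop.comp hv)))
  have h1 : (fun d : ℕ => (d : ℝ) - 1) ~[atTop] (fun d : ℕ => (d : ℝ)) := by
    simpa only [sub_eq_add_neg] using hadd IsEquivalent.refl htop (-1)
  have h2 : (fun d : ℕ => (d : ℝ) - 1 - 1) ~[atTop] (fun d : ℕ => (d : ℝ)) := by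
    simpa only [sub_eq_add_neg] using hadd h1 htop (-1)
  have h3 : ∀ n, n ≠ 0 → (fun d : ℕ => ((d : ℝ) - 1) ^ n + 1) ~[atTop]
      (fun d : ℕ => (d : ℝ) ^ n) := fun n hn =>
    hadd (h1.pow n) ((tendsto_pow_atTop hn).comp htop) 1
  -- Each factor is equivalent to its leading power of `d`, and `3 + 2 + 2 + 7 = 14`.
  have h4 := ((((IsEquivalent.refl (u := fun _ : ℕ => (1 / 16 : ℝ)) (l := atTop)).mul
    (h3 3 (by norm_num))).mul (h3 2 (by norm_num))).mul (h2.pow 2)).mul (h1.pow 7)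
  refine h4.congr_right (Eventually.of_forall fun d => ?_)
  simp only [Pi.mul_apply, Pi.pow_apply]
  ring

theorem mainTheorem10 :
    (∀ (k : Type*) [Field k] [IsAlgClosed k] (p e q d : ℕ) [CharP k p],
      p.Prime → 1 ≤ e → q = p ^ e → d = q + 1 → 5 ≤ d →
      ∀ F : MvPolynomial (Fin 4) k, IsSmoothExtremalSurface q F →
        (((q ^ 3 + 1) * (q ^ 2 + 1) * (q - 1) ^ 2 * q ^ 7 : ℕ) : ℕ∞)
          ≤ 16 * (doublesOn d F).encard) ∧
    (fun d : ℕ => (1 / 16 : ℝ) * (((d : ℝ) - 1) ^ 3 + 1) * (((d : ℝ) - 1) ^ 2 + 1)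
        * (((d : ℝ) - 1) - 1) ^ 2 * ((d : ℝ) - 1) ^ 7)
      ~[atTop] (fun d : ℕ => (1 / 16 : ℝ) * (d : ℝ) ^ 14) := by
  refine ⟨?_, doubleCount_isEquivalent⟩
  intro k _ _ p e q d _ hp he hq hd hd5 F hF
  subst hd
  have : Fact p.Prime := ⟨hp⟩
  have hσ : ∀ x, iterateFrobenius k p e x = x ^ q := fun x => by rw [iterateFrobenius_def, hq]
  have hq0 : (q : k) = 0 := by
    rw [hq, Nat.cast_pow, CharP.cast_eq_zero, zero_pow (by omega)]
  exact le_encard_doublesOn (by omega) _ hσ hq0 hF
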